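/- **Setting.** Let $G$ be a diffeological group, $\mathbb Z_2=\{\pm1\}$ (discrete), $\sigma:\mathbb Z_2\to\operatorname{Aut}(G)$ an action by smooth automorphisms, and $H_\sigma=G\rtimes_\sigma\mathbb Z_2$. Let $1\to U(1)\to\widehat G\xrightarrow{q}G\to1$ be a central extension of diffeological groups ($U(1)\to\widehat G$ is an induction, $q$ a subduction) and $\widehat\sigma:\mathbb Z_2\to\operatorname{Aut}(\widehat G)$ an action by smooth automorphisms with $q\circ\widehat\sigma^{\varepsilon}=\sigma^\varepsilon\circ q$. Then $\mathbb Z_2$ acts on $U(1)$ by $z\mapsto z^{\chi(\varepsilon)}$ for a character $\chi:\mathbb Z_2\to\{\pm1\}$, and it acts on $\mathbb R$ and $\mathbb Z$ through $\chi$. $E^{\mathrm{sph}}(G)$ is the set of sequences $(x_i,g_i)_{i\in\mathbb N}$ with $x_i\in\mathbb R$ finitely supported, $\sum x_i^2=1$, $g_i\in G$, modulo $(x_i,g_i)\sim(x_i,g_i')$ iff $g_i=g_i'$ whenever $x_i\ne0$, with the final diffeology of the maps $S_I\times G^I\to E^{\mathrm{sph}}(G)$, where $I\subset\mathbb N$ is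 finite and $S_I\subset\mathbb R^I$ is the unit sphere. The group $H_\sigma$ acts by $(h,\varepsilon)\cdot[(x_i,g_i)]=[(\varepsilon x_i,h\,\sigma^\varepsilon(g_i))]$, and $B^{\mathrm{sph}}_\sigma(G)=E^{\mathrm{sph}}(G)/H_\sigma$ has the quotient diffeology. Then $E^{\mathrm{sph}}(G)\to B^{\mathrm{sph}}_\sigma(G)$ is a diffeological principal $H_\sigma$-bundle, the universal bundle (principal groups act from the left). **Cohomology.** For a diffeological space $X$, consider the category of Euclidean plots $p:\mathbb R^n\to X$, $n\ge0$, a morphism $\varphi:p\to p'$ being a smooth map with $p'\circ\varphi=p$. For a presheaf $F$ of abelian groups on it, $H^k(X;F)$ is the cohomology of the Čech-type complex whose $k$-cochains assign to each chain $p_0\to\cdots\to p_k$ an element of $F(p_0)$. For a principal $H_\sigma$-bundle $P\to X$ and $M=\mathbb Z,\mathbb R,U(1)$, the local system $M_{\alpha(P)}$ assigns to $p$ the smooth maps $m:p^*P\to M$ with $m((g,\varepsilon)\cdot y)=\chi(\varepsilon)\cdot m(y)$. **Twisting data.** Choose smooth sections $s_p:\mathbb R^n\to P$ of $P$ over all Euclidean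 plots $p$, with transition functions $h_\varphi=(g_\varphi,\varepsilon_\varphi)$ defined by $s_p=h_\varphi\cdot(s_{p'}\circ\varphi)$ for $\varphi:p\to p'$, and smooth lifts $\widehat g_\varphi$ of $g_\varphi$ to $\widehat G$. Set * $\alpha(P)=[\varepsilon_\varphi]\in H^1(X;\mathbb Z_2)$; * $\beta(P)=[a]\in H^2(X;U(1)_{\alpha(P)})$, where for $p\xrightarrow{\varphi}p'\xrightarrow{\psi}p''$ the section $a_{\varphi,\psi}$ takes at $s_p$ the value $\widehat g_\varphi\,\widehat\sigma^{\varepsilon_\varphi}(\widehat g_\psi\circ\varphi)\,\widehat g_{\psi\circ\varphi}^{-1}\in U(1)$; * $\operatorname{DD}_\alpha(P)\in H^3(X;\mathbb Z_{\alpha(P)})$, the image of $\beta(P)$ under the connecting morphism of $0\to\mathbb Z_{\alpha(P)}\to\mathbb R_{\alpha(P)}\to U(1)_{\alpha(P)}\to0$ (the second map being $t\mapsto e^{2\pi i t}$). The spherical twisting datum of $P$ is $\tau(P)=(\alpha(P),\operatorname{DD}_\alpha(P))$, and $\tau_{\mathrm{univ}}=(\alpha_{\mathrm{univ}},\operatorname{DD}_{\mathrm{univ}})$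 is that of the universal bundle. **Theorem.** Let $P\to X$ be a diffeological principal $H_\sigma$-bundle over a diffeological space, classified by $f_P$: that is, $f_P:X\to B^{\mathrm{sph}}_\sigma(G)$ is smooth and $\Phi:P\cong f_P^*E^{\mathrm{sph}}(G)$ is an isomorphism of principal bundles. Then $\tau_{\mathrm{univ}}$ and $\tau(P)$ are well defined (they exist and do not depend on the choices made), and $$\tau(P)=f_P^*(\tau_{\mathrm{univ}}),$$ that is, $\alpha(P)=f_P^*\alpha_{\mathrm{univ}}$ in $H^1(X;\mathbb Z_2)$ and $\operatorname{DD}_\alpha(P)=f_P^*\operatorname{DD}_{\mathrm{univ}}$ in $H^3(X;\mathbb Z_{\alpha(P)})$, where $f_P^*\mathbb Z_{\alpha_{\mathrm{univ}}}$ is identified with $\mathbb Z_{\alpha(P)}$ through $\Phi$. -/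

import Mathlib

open Diffeology CategoryTheory Opposite Topology
open scoped ContDiff

noncomputable section

namespace SphericalTwist

universe u v w

/-! ### Diffeologies: initial, product, discrete and final diffeologies -/

/-- Euclidean space `ℝⁿ`. -/
abbrev Euc (n : ℕ) : Type := EuclideanSpace ℝ (Fin n)

lemma isPlot_of_nhds {X : Type*} [DiffeologicalSpace X] {n : ℕ} {p : Euc n → X}
    (h : ∀ x, ∃ q : Euc n → X, IsPlot q ∧ p =ᶠ[𝓝 x] q) : IsPlot p := by
  refine DiffeologicalSpace.locality fun x => ?_
  obtain ⟨q, hq, hpq⟩ := h x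
  obtain ⟨s, hs, hso, hxs⟩ := eventually_nhds_iff.1 hpq
  refine ⟨s, hso, hxs, fun {m f} hf hfs => ?_⟩
  have : p ∘ f = q ∘ f := funext fun y => hs _ (hf y)
  rw [this]
  exact isPlot_reparam hq hfs

/-- A smooth self-map of `ℝⁿ` with values in a given neighbourhood of a point, which is the
identity near that point. -/
lemma exists_smooth_retract {n : ℕ} (x : Euc n) {s : Set (Euc n)} (hs : IsOpen s) (hx : x ∈ s) :
    ∃ f : Euc n → Euc n, ContDiff ℝ ∞ f ∧ (∀ y, f y ∈ s) ∧ f =ᶠ[𝓝 x] id := by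
  obtain ⟨ε, hε, hball⟩ := Metric.isOpen_iff.1 hs x hx
  let b : ContDiffBump x := ⟨ε / 2, ε, by positivity, by linarith⟩
  refine ⟨fun y => x + b y • (y - x), ?_, fun y => hball ?_, ?_⟩
  · exact contDiff_const.add (b.contDiff.smul (contDiff_id.sub contDiff_const))
  · rw [Metric.mem_ball, dist_eq_norm, add_sub_cancel_left, norm_smul, Real.norm_eq_abs,
      abs_of_nonneg b.nonneg]
    by_cases hy : dist y x < ε
    · rw [dist_eq_norm] at hy
      calc b y * ‖y - x‖ ≤ 1 * ‖y - x‖ := by gcongr; exact b.le_one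
        _ < ε := by simpa using hy
    · have : b y = 0 := b.zero_of_le_dist (by simpa [b] using not_lt.1 hy)
      simpa [this] using hε
  · filter_upwards [b.eventuallyEq_one] with y hy
    simp [hy]

/-- The initial diffeology along a map `f`: `p` is a plot iff `f ∘ p` is one. -/
abbrev inducedDiffeology {X Y : Type*} (f : X → Y) [DiffeologicalSpace Y] : DiffeologicalSpace X where
  plots _ := {p | IsPlot (f ∘ p)}
  constant_plots x := isPlot_const (x := f x)
  plot_reparam hp hf := isPlot_reparam hp hf
  locality h := DiffeologicalSpace.locality (p := f ∘ _) h

instance instSubtype {X : Type*} [DiffeologicalSpace X] (s : X → Prop) :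
    DiffeologicalSpace (Subtype s) := inducedDiffeology Subtype.val

instance instProd {X Y : Type*} [DiffeologicalSpace X] [DiffeologicalSpace Y] :
    DiffeologicalSpace (X × Y) where
  plots _ := {p | IsPlot (fun u => (p u).1) ∧ IsPlot (fun u => (p u).2)}
  constant_plots x := ⟨isPlot_const (x := x.1), isPlot_const (x := x.2)⟩
  plot_reparam hp hf := ⟨isPlot_reparam hp.1 hf, isPlot_reparam hp.2 hf⟩
  locality h :=
    ⟨DiffeologicalSpace.locality fun x =>
        let ⟨s, hs, hx, H⟩ := h x; ⟨s, hs, hx, fun a b => (H a b).1⟩,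
      DiffeologicalSpace.locality fun x =>
        let ⟨s, hs, hx, H⟩ := h x; ⟨s, hs, hx, fun a b => (H a b).2⟩⟩

instance instPi {ι : Type*} {X : ι → Type*} [∀ i, DiffeologicalSpace (X i)] :
    DiffeologicalSpace (∀ i, X i) where
  plots _ := {p | ∀ i, IsPlot (fun u => p u i)}
  constant_plots x := fun i => isPlot_const (x := x i)
  plot_reparam hp hf := fun i => isPlot_reparam (hp i) hf
  locality h := fun i => DiffeologicalSpace.locality fun x =>
    let ⟨s, hs, hx, H⟩ := h x; ⟨s, hs, hx, fun a b => H a b i⟩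

/-- The discrete diffeology: the plots are the locally constant maps. -/
abbrev discreteDiffeology (X : Type*) : DiffeologicalSpace X where
  plots _ := {p | IsLocallyConstant p}
  constant_plots x := IsLocallyConstant.const x
  plot_reparam hp hf := hp.comp_continuous hf.continuous
  locality {n p} h := by
    refine (IsLocallyConstant.iff_eventually_eq p).2 fun x => ?_
    obtain ⟨s, hs, hx, H⟩ := h x
    obtain ⟨f, hf, hfs, hfx⟩ := exists_smooth_retract x hs hx
    have h1 := (IsLocallyConstant.iff_eventually_eq _).1 (H hfs hf) x
    filter_upwards [h1, hfx] with y hy hy'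
    have := hfx.eq_of_nhds
    simp_all

instance instInt : DiffeologicalSpace ℤ := discreteDiffeology ℤ

/-- `ℤ₂ = {±1}` is a discrete diffeological group. -/
instance instUnits : DiffeologicalSpace ℤˣ := discreteDiffeology ℤˣ

/-- `U(1)` carries the subset diffeology of `ℂ`: the plots are the smooth maps to the circle. -/
instance instCircle : DiffeologicalSpace Circle :=
  @inducedDiffeology _ _ (fun z : Circle => (z : ℂ)) (NormedSpace.toDiffeology ℂ)

instance instAdditive {M : Type*} [d : DiffeologicalSpace M] : DiffeologicalSpace (Additive M) := d

/-- The final diffeology of a family of maps: the finest diffeology making all of them smooth. -/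
abbrev finalDiffeology {ι : Type*} {X : ι → Type*} [∀ i, DiffeologicalSpace (X i)] {Y : Type*}
    (f : ∀ i, X i → Y) : DiffeologicalSpace Y :=
  DiffeologicalSpace.generateFrom
    {q | ∃ (i : ι) (p : Euc q.1 → X i), IsPlot p ∧ q.2 = f i ∘ p}

/-- The quotient diffeology: the finest diffeology making the projection smooth. -/
instance instQuotient {X : Type*} [DiffeologicalSpace X] (s : Setoid X) :
    DiffeologicalSpace (Quotient s) :=
  finalDiffeology (fun _ : Unit => (Quotient.mk s : X → Quotient s))

lemma final_smooth {ι : Type*} {X : ι → Type*} [∀ i, DiffeologicalSpace (X i)] {Y : Type*}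
    (f : ∀ i, X i → Y) (i : ι) {n : ℕ} {p : Euc n → X i} (hp : IsPlot p) :
    (@IsPlot _ (finalDiffeology f)) (f i ∘ p) :=
  DiffeologicalSpace.isPlot_generatedFrom_of_mem ⟨i, p, hp, rfl⟩

/-- For a jointly surjective family, the plots of the final diffeology are the maps that locally
lift to a plot of a member of the family. -/
lemma final_locally_lifts {ι : Type*} {X : ι → Type*} [∀ i, DiffeologicalSpace (X i)] {Y : Type*}
    (f : ∀ i, X i → Y) (hf : ∀ y, ∃ i x, f i x = y) {n : ℕ} {q : Euc n → Y}
    (hq : (@IsPlot _ (finalDiffeology f)) q) (x : Euc n) :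
    ∃ (i : ι) (p : Euc n → X i), IsPlot p ∧ q =ᶠ[𝓝 x] f i ∘ p := by
  let d : DiffeologicalSpace Y :=
    { plots := fun n => {q | ∀ x : Euc n, ∃ (i : ι) (p : Euc n → X i),
        IsPlot p ∧ q =ᶠ[𝓝 x] f i ∘ p}
      constant_plots := fun {n} y x => by
        obtain ⟨i, z, hz⟩ := hf y
        exact ⟨i, fun _ => z, isPlot_const, by simp [Function.comp_def, hz]⟩
      plot_reparam := fun {n m p g} hp hg x => by
        obtain ⟨i, r, hr, h⟩ := hp (g x)
        exact ⟨i, r ∘ g, isPlot_reparam hr hg, hg.continuous.continuousAt.eventually h⟩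
      locality := fun {n p} h x => by
        obtain ⟨s, hs, hx, H⟩ := h x
        obtain ⟨g, hg, hgs, hgx⟩ := exists_smooth_retract x hs hx
        obtain ⟨i, r, hr, h'⟩ := H hgs hg x
        refine ⟨i, r, hr, ?_⟩
        filter_upwards [h', hgx] with y hy hy'
        simpa [hy'] using hy }
  have hle : finalDiffeology f ≤ d := by
    refine DiffeologicalSpace.generateFrom_le_iff.2 fun n q hq x => ?_
    obtain ⟨i, p, hp, hqp⟩ := hq
    exact ⟨i, p, hp, Filter.EventuallyEq.of_eq hqp⟩
  exact DiffeologicalSpace.le_iff'.1 hle n q hq x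

/-- A group with a diffeology for which multiplication and inversion are smooth. -/
class DiffeologicalGroup (G : Type*) [Group G] [DiffeologicalSpace G] : Prop where
  smooth_mul : DSmooth fun z : G × G => z.1 * z.2
  smooth_inv : DSmooth fun g : G => g⁻¹

/-- An additive group with a diffeology for which addition and negation are smooth. -/
class DiffeologicalAddGroup (M : Type*) [AddGroup M] [DiffeologicalSpace M] : Prop where
  smooth_add : DSmooth fun z : M × M => z.1 + z.2
  smooth_neg : DSmooth fun m : M => -m

lemma IsPlot.mul' {G : Type*} [Group G] [DiffeologicalSpace G] [DiffeologicalGroup G] {n : ℕ}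
    {p q : Euc n → G} (hp : IsPlot p) (hq : IsPlot q) : IsPlot (fun u => p u * q u) :=
  DiffeologicalGroup.smooth_mul n (fun u => (p u, q u)) ⟨hp, hq⟩

lemma IsPlot.inv' {G : Type*} [Group G] [DiffeologicalSpace G] [DiffeologicalGroup G] {n : ℕ}
    {p : Euc n → G} (hp : IsPlot p) : IsPlot (fun u => (p u)⁻¹) :=
  DiffeologicalGroup.smooth_inv n p hp

instance : DiffeologicalAddGroup ℤ where
  smooth_add _ p hp := by
    have h1 : IsLocallyConstant (fun u => (p u).1) := hp.1
    have h2 : IsLocallyConstant (fun u => (p u).2) := hp.2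
    exact h1.add h2
  smooth_neg _ p hp := by
    have h1 : IsLocallyConstant p := hp
    exact h1.neg

instance : DiffeologicalAddGroup ℝ where
  smooth_add _ p hp := (hp.1.contDiff.add hp.2.contDiff).isPlot
  smooth_neg _ p hp := hp.contDiff.neg.isPlot

lemma isPlot_circle_iff {n : ℕ} {p : Euc n → Circle} :
    IsPlot p ↔ ContDiff ℝ ∞ fun u => (p u : ℂ) := Iff.rfl

instance : DiffeologicalAddGroup (Additive Circle) where
  smooth_add _ p hp := by
    have h1 : ContDiff ℝ ∞ fun u => ((p u).1.toMul : ℂ) := hp.1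
    have h2 : ContDiff ℝ ∞ fun u => ((p u).2.toMul : ℂ) := hp.2
    have h3 : ContDiff ℝ ∞ fun u => ((p u).1.toMul : ℂ) * ((p u).2.toMul : ℂ) := h1.mul h2
    refine (isPlot_circle_iff (p := fun u => (p u).1.toMul * (p u).2.toMul)).2 ?_
    simpa using h3
  smooth_neg _ p hp := by
    have h1 : ContDiff ℝ ∞ fun u => ((p u).toMul : ℂ) := hp
    refine (isPlot_circle_iff (p := fun u => (p u).toMul⁻¹)).2 ?_
    have h2 : ContDiff ℝ ∞ fun u => Complex.conjCLE ((p u).toMul : ℂ) :=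
      Complex.conjCLE.contDiff.comp h1
    simpa only [Circle.coe_inv_eq_conj, Complex.conjCLE_apply] using h2

/-! ### Principal bundles -/

/-- A map is a subduction if it is smooth and surjective and every plot of the target lifts locally
to a plot of the source (that is, the target carries the quotient diffeology). -/
structure IsSubduction {X Y : Type*} [DiffeologicalSpace X] [DiffeologicalSpace Y]
    (f : X → Y) : Prop where
  smooth : DSmooth f
  surjective : Function.Surjective f
  lifts : ∀ (n : ℕ) (p : Euc n → Y), IsPlot p → ∀ x, ∃ q : Euc n → X,
    IsPlot q ∧ p =ᶠ[𝓝 x] f ∘ q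

/-- A diffeological principal `H`-bundle over `X` (the group acting from the left): a smooth action
on the total space such that `(h, y) ↦ (y, h • y)` is a diffeomorphism onto the fibre product over
`X` (`free_transitive` gives bijectivity, `smooth_div` smoothness of the inverse), and such that the
projection is a subduction. -/
structure PrincipalBundle (H : Type u) [Group H] [DiffeologicalSpace H] (X : Type v)
    [DiffeologicalSpace X] where
  Total : Type w
  [diffeology : DiffeologicalSpace Total]
  [action : MulAction H Total]
  proj : Total → X
  subduction : IsSubduction proj
  proj_smul : ∀ (h : H) (y : Total), proj (h • y) = proj y
  smooth_smul : DSmooth fun z : H × Total => z.1 • z.2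
  free_transitive : ∀ y z : Total, proj y = proj z → ∃! h : H, y = h • z
  smooth_div : ∀ (n : ℕ) (h : Euc n → H) (z : Euc n → Total),
    IsPlot z → IsPlot (fun x => h x • z x) → IsPlot h

attribute [instance] PrincipalBundle.diffeology PrincipalBundle.action

namespace PrincipalBundle

variable {H : Type*} [Group H] [DiffeologicalSpace H] {X Y : Type*} [DiffeologicalSpace X]
  [DiffeologicalSpace Y]

/-- The element `h` with `y = h • z`, for two points of the same fibre. -/
def div (P : PrincipalBundle H X) {y z : P.Total} (h : P.proj y = P.proj z) : H :=
  (P.free_transitive y z h).choose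

/-- The total space of the pull-back: the fibre product with its subset diffeology. -/
abbrev PullbackTotal (P : PrincipalBundle H X) (f : Y → X) : Type _ :=
  {z : Y × P.Total // P.proj z.2 = f z.1}

instance (P : PrincipalBundle H X) (f : Y → X) : MulAction H (P.PullbackTotal f) where
  smul h z := ⟨(z.1.1, h • z.1.2), (P.proj_smul h z.1.2).trans z.2⟩
  one_smul z := Subtype.ext (Prod.ext rfl (one_smul H z.1.2))
  mul_smul h k z := Subtype.ext (Prod.ext rfl (mul_smul h k z.1.2))

/-- The pull-back of a principal bundle along a smooth map. -/
def pullback (P : PrincipalBundle H X) (f : Y → X) (hf : DSmooth f) : PrincipalBundle H Y where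
  Total := P.PullbackTotal f
  proj z := z.1.1
  subduction :=
    { smooth := fun _ _ hp => hp.1
      surjective := fun y => by
        obtain ⟨z, hz⟩ := P.subduction.surjective (f y)
        exact ⟨⟨(y, z), hz⟩, rfl⟩
      lifts := fun n p hp x => by
        obtain ⟨q, hq, h⟩ := P.subduction.lifts n _ (hf n p hp) x
        obtain ⟨s, hs, hso, hxs⟩ := eventually_nhds_iff.1 h
        obtain ⟨g, hg, hgs, hgx⟩ := exists_smooth_retract x hso hxs
        refine ⟨fun u => ⟨(p (g u), q (g u)), (hs _ (hgs u)).symm⟩,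
          ⟨isPlot_reparam hp hg, isPlot_reparam hq hg⟩, ?_⟩
        filter_upwards [hgx] with y hy
        simp [hy] }
  proj_smul _ _ := rfl
  smooth_smul n p hp :=
    ⟨hp.2.1, P.smooth_smul n (fun u => ((p u).1, (p u).2.1.2)) ⟨hp.1, hp.2.2⟩⟩
  free_transitive y z h := by
    have h' : P.proj y.1.2 = P.proj z.1.2 := by rw [y.2, z.2]; exact congrArg f h
    obtain ⟨k, hk, hu⟩ := P.free_transitive _ _ h'
    exact ⟨k, Subtype.ext (Prod.ext h hk), fun k' hk' => hu k' (congrArg (fun t => t.1.2) hk')⟩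
  smooth_div n h z hz hhz := P.smooth_div n h _ hz.2 hhz.2

/-- Isomorphisms of principal `H`-bundles over `X`. -/
structure Iso (P Q : PrincipalBundle H X) where
  toEquiv : P.Total ≃ Q.Total
  smooth_toFun : DSmooth toEquiv
  smooth_invFun : DSmooth toEquiv.symm
  proj_comp : ∀ y, Q.proj (toEquiv y) = P.proj y
  equivariant : ∀ (h : H) (y : P.Total), toEquiv (h • y) = h • toEquiv y

end PrincipalBundle

/-! ### The spherical Milnor space and the universal bundle -/

section Milnor

variable (G : Type u) [Group G] [DiffeologicalSpace G]

/-- Labelled sequences `(xᵢ, gᵢ)` with finitely supported `x` and `∑ xᵢ² = 1`. -/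
abbrev PreSph : Type u := {z : (ℕ →₀ ℝ) × (ℕ → G) // (z.1.sum fun _ t => t ^ 2) = 1}

/-- `(xᵢ, gᵢ) ∼ (xᵢ, gᵢ')` iff `gᵢ = gᵢ'` whenever `xᵢ ≠ 0`. -/
def sphSetoid : Setoid (PreSph G) where
  r a b := a.1.1 = b.1.1 ∧ ∀ i, a.1.1 i ≠ 0 → a.1.2 i = b.1.2 i
  iseqv := ⟨fun _ => ⟨rfl, fun _ _ => rfl⟩,
    fun h => ⟨h.1.symm, fun i hi => (h.2 i (h.1 ▸ hi)).symm⟩,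
    fun h k => ⟨h.1.trans k.1, fun i hi => (h.2 i hi).trans (k.2 i (h.1 ▸ hi))⟩⟩

/-- The spherical Milnor space `E^sph(G)`. -/
def ESph : Type u := Quotient (sphSetoid G)

/-- The unit sphere `S_I` of `ℝ^I`, for a finite set `I` of indices. -/
abbrev SphereOn (I : Finset ℕ) : Type := {x : EuclideanSpace ℝ I // ∑ i, x i ^ 2 = 1}

variable {G}

/-- Extension of a finite coordinate vector by zero. -/
def extendZero (I : Finset ℕ) (x : EuclideanSpace ℝ I) : ℕ →₀ ℝ :=
  Finsupp.onFinset I (fun i => if h : i ∈ I then x ⟨i, h⟩ else 0) fun i hi => by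
    by_contra h
    simp [h] at hi

lemma extendZero_sum (I : Finset ℕ) (x : EuclideanSpace ℝ I) :
    ((extendZero I x).sum fun _ t => t ^ 2) = ∑ i, x i ^ 2 := by
  rw [extendZero, Finsupp.onFinset_sum _ (by simp), ← Finset.sum_coe_sort]
  exact Finset.sum_congr rfl fun i _ => by simp

/-- The local model `ψ_I : S_I × G^I → E^sph(G)`. -/
def sphChart (I : Finset ℕ) (z : SphereOn I × (I → G)) : ESph G :=
  Quotient.mk (sphSetoid G)
    ⟨(extendZero I z.1.1, fun i => if h : i ∈ I then z.2 ⟨i, h⟩ else 1),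
      (extendZero_sum I z.1.1).trans z.1.2⟩

/-- `E^sph(G)` carries the final diffeology of the local models `S_I × G^I`, with `I` running over
the finite sets of indices. -/
instance : DiffeologicalSpace (ESph G) := finalDiffeology (fun I : Finset ℕ => sphChart (G := G) I)

lemma sphChart_jointly_surjective (e : ESph G) : ∃ (I : Finset ℕ) (z : _), sphChart (G := G) I z = e := by
  induction e using Quotient.ind with
  | _ a =>
  obtain ⟨⟨x, g⟩, hx⟩ := a
  have hext : extendZero x.support (WithLp.toLp 2 fun i => x i) = x := by
    ext i
    simp only [extendZero, Finsupp.onFinset_apply]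
    split_ifs with h
    · rfl
    · exact (Finsupp.notMem_support_iff.1 h).symm
  refine ⟨x.support, ⟨⟨WithLp.toLp 2 fun i => x i, ?_⟩, fun i => g i⟩, ?_⟩
  · rw [← extendZero_sum, hext]; exact hx
  · refine Quotient.sound ⟨hext, fun i hi => ?_⟩
    have hi' : x i ≠ 0 := by simpa [hext] using hi
    simp [hi']

/-- The semidirect product `H_σ = G ⋊_σ ℤ₂`, with
`(g, ε) (g', ε') = (g σ^ε(g'), ε ε')`. -/
abbrev HGroup (σ : ℤˣ →* MulAut G) : Type u := G ⋊[σ] ℤˣ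

/-- `H_σ` carries the product diffeology. -/
instance (σ : ℤˣ →* MulAut G) : DiffeologicalSpace (HGroup σ) :=
  inducedDiffeology fun h : HGroup σ => (h.left, h.right)

lemma scale_sum (ε : ℤˣ) (x : ℕ →₀ ℝ) :
    (((ε : ℤ) : ℝ) • x).sum (fun _ t => t ^ 2) = x.sum fun _ t => t ^ 2 := by
  rw [Finsupp.sum_smul_index' (by simp)]
  rcases Int.units_eq_one_or ε with rfl | rfl <;> simp

/-- The twisted action on labelled sequences: `(h, ε) · (xᵢ, gᵢ) = (ε xᵢ, h σ^ε(gᵢ))`. -/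
def preAct {σ : ℤˣ →* MulAut G} (h : HGroup σ) (a : PreSph G) : PreSph G :=
  ⟨(((h.right : ℤ) : ℝ) • a.1.1, fun i => h.left * σ h.right (a.1.2 i)),
    (scale_sum h.right a.1.1).trans a.2⟩

/-- The `σ`-twisted action of `H_σ` on `E^sph(G)`. -/
instance (σ : ℤˣ →* MulAut G) : MulAction (HGroup σ) (ESph G) where
  smul h := Quotient.map (sa := sphSetoid G) (sb := sphSetoid G) (preAct h) fun a b hab => by
    refine ⟨by simp [preAct, hab.1], fun i hi => ?_⟩
    have : a.1.1 i ≠ 0 := fun h0 => hi (by simp [preAct, h0])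
    simp [preAct, hab.2 i this]
  one_smul e := by
    induction e using Quotient.ind with
    | _ a => exact congrArg _ (Subtype.ext (Prod.ext (by simp [preAct]) (by ext; simp [preAct])))
  mul_smul h k e := by
    induction e using Quotient.ind with
    | _ a =>
    refine congrArg _ (Subtype.ext (Prod.ext ?_ ?_))
    · ext i; simp [preAct, mul_assoc]
    · ext i; simp [preAct, mul_assoc]

/-- The `σ`-twisted spherical classifying space `B^sph_σ(G) = E^sph(G) / H_σ`. -/
abbrev BSph (σ : ℤˣ →* MulAut G) : Type u :=
  Quotient (MulAction.orbitRel (HGroup σ) (ESph G))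

lemma smul_mk {σ : ℤˣ →* MulAut G} (h : HGroup σ) (a : PreSph G) :
    h • (show ESph G from Quotient.mk (sphSetoid G) a) = Quotient.mk (sphSetoid G) (preAct h a) :=
  rfl

lemma extendZero_apply (I : Finset ℕ) (x : EuclideanSpace ℝ I) (i : ℕ) :
    extendZero I x i = if h : i ∈ I then x ⟨i, h⟩ else 0 := rfl

lemma units_smul_sphere (ε : ℤˣ) {I : Finset ℕ} (x : SphereOn I) :
    ∑ i, ((((ε : ℤ) : ℝ) • x.1 : EuclideanSpace ℝ I) i) ^ 2 = 1 := by
  refine (Finset.sum_congr rfl fun i _ => ?_).trans x.2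
  rcases Int.units_eq_one_or ε with rfl | rfl <;> simp

lemma smul_sphChart {σ : ℤˣ →* MulAut G} (h : HGroup σ) (I : Finset ℕ)
    (z : SphereOn I × (I → G)) :
    h • sphChart I z = sphChart I (⟨((h.right : ℤ) : ℝ) • z.1.1, units_smul_sphere h.right z.1⟩,
      fun i => h.left * σ h.right (z.2 i)) := by
  refine (smul_mk h _).trans (Quotient.sound ⟨?_, fun i hi => ?_⟩)
  · ext i
    simp [preAct, extendZero_apply]
  · by_cases hI : i ∈ I
    · simp [preAct, hI]
    · simp [preAct, extendZero_apply, hI] at hi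

lemma exists_ne_zero {I : Finset ℕ} (x : SphereOn I) : ∃ i, x.1 i ≠ 0 := by
  by_contra! h
  simpa [h] using x.2

/-- The universal principal `H_σ`-bundle `E^sph(G) → B^sph_σ(G)`. -/
def universalBundle [DiffeologicalGroup G] (σ : ℤˣ →* MulAut G) (hσ : ∀ ε, DSmooth (σ ε)) :
    PrincipalBundle (HGroup σ) (BSph σ) where
  Total := ESph G
  proj := Quotient.mk _
  subduction :=
    { smooth := fun _ _ hp => final_smooth _ () hp
      surjective := Quotient.mk_surjective
      lifts := fun _ _ hp x => by
        obtain ⟨_, q, hq, h⟩ :=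
          final_locally_lifts _ (fun y => ⟨(), Quotient.exists_rep y⟩) hp x
        exact ⟨q, hq, h⟩ }
  proj_smul h y := Quotient.sound ⟨h, rfl⟩
  smooth_smul n p hp := by
    refine isPlot_of_nhds fun x => ?_
    obtain ⟨I, r, hr, hpr⟩ := final_locally_lifts _ sphChart_jointly_surjective hp.2 x
    have hl : IsPlot fun u => (p u).1.left := hp.1.1
    have hε : IsLocallyConstant fun u => (p u).1.right := hp.1.2
    obtain ⟨ε, hεdef⟩ : ∃ ε, (p x).1.right = ε := ⟨_, rfl⟩
    refine ⟨sphChart I ∘ fun u => (⟨((ε : ℤ) : ℝ) • (r u).1.1, units_smul_sphere ε (r u).1⟩,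
      fun i => (p u).1.left * σ ε ((r u).2 i)), final_smooth _ I ⟨?_, fun i => ?_⟩, ?_⟩
    · have h1 : IsPlot fun u => (r u).1.1 := hr.1
      exact (h1.contDiff.const_smul ((ε : ℤ) : ℝ)).isPlot
    · exact IsPlot.mul' hl (hσ ε n _ (hr.2 i))
    · filter_upwards [hpr, (IsLocallyConstant.iff_eventually_eq _).1 hε x] with u h1 h2
      simp only [Function.comp_apply] at h1 ⊢
      rw [hεdef] at h2
      rw [h1, smul_sphChart, h2]
  free_transitive y z h := by
    obtain ⟨k, hk⟩ : MulAction.orbitRel (HGroup σ) (ESph G) y z := Quotient.exact h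
    refine ⟨k, hk.symm, fun k' hk' => ?_⟩
    have hkk : k' • z = k • z := hk'.symm.trans hk.symm
    obtain ⟨I, w, rfl⟩ := sphChart_jointly_surjective z
    obtain ⟨i, hi⟩ := exists_ne_zero w.1
    rw [smul_sphChart, smul_sphChart] at hkk
    have hq := Quotient.exact hkk
    have h1 := DFunLike.congr_fun hq.1 i.1
    have h2 := hq.2 i.1
    have hr : k'.right = k.right := by
      simp only [extendZero_apply, Finset.coe_mem, dif_pos, PiLp.smul_apply, smul_eq_mul] at h1
      have h3 := mul_right_cancel₀ hi h1
      exact Units.ext (Int.cast_injective (α := ℝ) h3)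
    have hl := h2 (by
      simp only [extendZero_apply, Finset.coe_mem, dif_pos, PiLp.smul_apply, smul_eq_mul]
      exact mul_ne_zero (by simp) hi)
    simp only [Finset.coe_mem, dif_pos, hr] at hl
    exact SemidirectProduct.ext (mul_right_cancel hl) hr
  smooth_div n h z hz hhz := by
    refine isPlot_of_nhds fun x => ?_
    obtain ⟨I, r, hr, hzr⟩ := final_locally_lifts _ sphChart_jointly_surjective hz x
    obtain ⟨J, s, hs, hzs⟩ := final_locally_lifts _ sphChart_jointly_surjective hhz x
    obtain ⟨i, hi⟩ := exists_ne_zero (r x).1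
    have hrc : ContDiff ℝ ∞ fun u => (r u).1.1 := (show IsPlot fun u => (r u).1.1 from hr.1).contDiff
    have hsc : ContDiff ℝ ∞ fun u => (s u).1.1 := (show IsPlot fun u => (s u).1.1 from hs.1).contDiff
    have key : ∀ u, z u = sphChart I (r u) → h u • z u = sphChart J (s u) → (r u).1.1 i ≠ 0 →
        ∃ hJ : i.1 ∈ J, (s u).1.1 ⟨i, hJ⟩ = (((h u).right : ℤ) : ℝ) * (r u).1.1 i ∧
          (s u).2 ⟨i, hJ⟩ = (h u).left * σ (h u).right ((r u).2 i) := by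
      intro u h1 h2 h3
      rw [h1, smul_sphChart] at h2
      have hq := Quotient.exact h2
      have e1 := DFunLike.congr_fun hq.1 i.1
      have e2 := hq.2 i.1
      simp only [extendZero_apply, Finset.coe_mem, dif_pos, PiLp.smul_apply, smul_eq_mul] at e1 e2
      have hne : (((h u).right : ℤ) : ℝ) * (r u).1.1 i ≠ 0 := mul_ne_zero (by simp) h3
      by_cases hJ : i.1 ∈ J
      · rw [dif_pos hJ] at e1
        have e3 := e2 hne
        rw [dif_pos hJ] at e3
        exact ⟨hJ, e1.symm, e3.symm⟩
      · rw [dif_neg hJ] at e1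
        exact absurd e1 hne
    obtain ⟨hJ, hx1, -⟩ := key x hzr.eq_of_nhds hzs.eq_of_nhds hi
    set ε := (h x).right
    have c1 : Continuous fun u => (r u).1.1 i := by
      have := hrc.continuous; fun_prop
    have c2 : Continuous fun u => (s u).1.1 ⟨i, hJ⟩ := by
      have := hsc.continuous; fun_prop
    have n1 : ∀ᶠ u in 𝓝 x, (r u).1.1 i ≠ 0 := c1.continuousAt.eventually_ne hi
    have n2 : ∀ᶠ u in 𝓝 x, 0 < (s u).1.1 ⟨i, hJ⟩ * (((ε : ℤ) : ℝ) * (r u).1.1 i) := by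
      refine (c2.mul (continuous_const.mul c1)).continuousAt.eventually (lt_mem_nhds ?_)
      simp only [Pi.mul_apply]
      rw [hx1]
      exact mul_self_pos.2 (mul_ne_zero (by simp) hi)
    refine ⟨fun u => ⟨(s u).2 ⟨i, hJ⟩ * (σ ε ((r u).2 i))⁻¹, ε⟩, ⟨?_, isPlot_const (x := ε)⟩, ?_⟩
    · exact IsPlot.mul' (hs.2 _) (IsPlot.inv' (hσ ε n _ (hr.2 i)))
    · filter_upwards [hzr, hzs, n1, n2] with u h1 h2 h3 h4
      obtain ⟨_, e1, e2⟩ := key u h1 h2 h3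
      have hε : (h u).right = ε := by
        rw [e1] at h4
        rcases Int.units_eq_one_or (h u).right with h5 | h5 <;>
          rcases Int.units_eq_one_or ε with h6 | h6 <;> rw [h5, h6] at h4 ⊢ <;> simp at h4 <;>
          nlinarith [mul_self_nonneg ((r u).1.1 i)]
      refine SemidirectProduct.ext ?_ hε
      simp [e2, hε]

end Milnor

/-! ### Čech cohomology of a diffeological space -/

/-- A Euclidean plot of `X`, that is, a plot defined on some `ℝⁿ`. -/
structure EuclideanPlot (X : Type u) [DiffeologicalSpace X] where
  dim : ℕ
  map : Euc dim → X
  isPlot : IsPlot map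

namespace EuclideanPlot

variable {X : Type*} [DiffeologicalSpace X] {Y : Type*} [DiffeologicalSpace Y]

/-- A morphism `p ⟶ q` is a smooth map `φ` between the domains with `q ∘ φ = p`. -/
@[ext]
structure Hom (p q : EuclideanPlot X) where
  toFun : Euc p.dim → Euc q.dim
  smooth : ContDiff ℝ ∞ toFun
  comm : ∀ x, q.map (toFun x) = p.map x

instance : Category (EuclideanPlot X) where
  Hom := Hom
  id p := ⟨id, contDiff_id, fun _ => rfl⟩
  comp φ ψ := ⟨ψ.toFun ∘ φ.toFun, ψ.smooth.comp φ.smooth,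
    fun x => (ψ.comm _).trans (φ.comm x)⟩

/-- Composition of Euclidean plots with a smooth map. -/
def push (f : X → Y) (hf : DSmooth f) : EuclideanPlot X ⥤ EuclideanPlot Y where
  obj p := ⟨p.dim, f ∘ p.map, hf _ _ p.isPlot⟩
  map φ := ⟨φ.toFun, φ.smooth, fun x => congrArg f (φ.comm x)⟩

end EuclideanPlot

/-! Cochains on the nerve of a category with coefficients in a presheaf of abelian groups, in low
degrees: an `n`-cochain assigns to a chain `x₀ ⟶ ⋯ ⟶ xₙ` an element of `F(x₀)`. -/

namespace Cochain

variable {C : Type*} [Category C] (F : Cᵒᵖ ⥤ AddCommGrpCat)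

abbrev C0 : Type _ := ∀ x : C, F.obj (op x)

abbrev C1 : Type _ := ∀ ⦃x y : C⦄ (_ : x ⟶ y), F.obj (op x)

abbrev C2 : Type _ := ∀ ⦃x y z : C⦄ (_ : x ⟶ y) (_ : y ⟶ z), F.obj (op x)

abbrev C3 : Type _ := ∀ ⦃x y z w : C⦄ (_ : x ⟶ y) (_ : y ⟶ z) (_ : z ⟶ w), F.obj (op x)

abbrev C4 : Type _ :=
  ∀ ⦃x y z w t : C⦄ (_ : x ⟶ y) (_ : y ⟶ z) (_ : z ⟶ w) (_ : w ⟶ t), F.obj (op x)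

def d0 : C0 F →+ C1 F where
  toFun c := fun x y φ => F.map φ.op (c y) - c x
  map_zero' := by ext; simp
  map_add' a b := by ext; simp; abel

def d1 : C1 F →+ C2 F where
  toFun c := fun _ _ _ φ ψ => F.map φ.op (c ψ) - c (φ ≫ ψ) + c φ
  map_zero' := by ext; simp
  map_add' a b := by ext; simp; abel

def d2 : C2 F →+ C3 F where
  toFun c := fun _ _ _ _ φ ψ χ =>
    F.map φ.op (c ψ χ) - c (φ ≫ ψ) χ + c φ (ψ ≫ χ) - c φ ψ
  map_zero' := by ext; simp
  map_add' a b := by ext; simp; abel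

def d3 : C3 F →+ C4 F where
  toFun c := fun _ _ _ _ _ φ ψ χ θ =>
    F.map φ.op (c ψ χ θ) - c (φ ≫ ψ) χ θ + c φ (ψ ≫ χ) θ - c φ ψ (χ ≫ θ) + c φ ψ χ
  map_zero' := by ext; simp
  map_add' a b := by ext; simp; abel

/-- `Hⁿ` is the group of `n`-cocycles modulo the `n`-coboundaries. -/
abbrev H1 : Type _ := (d1 F).ker ⧸ (d0 F).range.addSubgroupOf (d1 F).ker

abbrev H2 : Type _ := (d2 F).ker ⧸ (d1 F).range.addSubgroupOf (d2 F).ker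

abbrev H3 : Type _ := (d3 F).ker ⧸ (d2 F).range.addSubgroupOf (d3 F).ker

/-- A map of coefficients `F(T x) → F'(x)` over a functor `T`, natural in `x`. -/
structure CoeffMap {C D : Type*} [Category C] [Category D] (T : C ⥤ D)
    (F : Dᵒᵖ ⥤ AddCommGrpCat) (F' : Cᵒᵖ ⥤ AddCommGrpCat) where
  app : ∀ x : C, F.obj (op (T.obj x)) →+ F'.obj (op x)
  naturality : ∀ {x y : C} (φ : x ⟶ y) (m : F.obj (op (T.obj y))),
    app x (F.map (T.map φ).op m) = F'.map φ.op (app y m)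

namespace CoeffMap

variable {C D : Type*} [Category C] [Category D] {T : C ⥤ D}
  {F : Dᵒᵖ ⥤ AddCommGrpCat} {F' : Cᵒᵖ ⥤ AddCommGrpCat} (η : CoeffMap T F F')

def pull0 : C0 F →+ C0 F' where
  toFun c := fun x => η.app x (c (T.obj x))
  map_zero' := by ext; simp
  map_add' _ _ := by ext; simp

def pull1 : C1 F →+ C1 F' where
  toFun c := fun x _ φ => η.app x (c (T.map φ))
  map_zero' := by ext; simp
  map_add' _ _ := by ext; simp

def pull2 : C2 F →+ C2 F' where
  toFun c := fun x _ _ φ ψ => η.app x (c (T.map φ) (T.map ψ))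
  map_zero' := by ext; simp
  map_add' _ _ := by ext; simp

def pull3 : C3 F →+ C3 F' where
  toFun c := fun x _ _ _ φ ψ χ => η.app x (c (T.map φ) (T.map ψ) (T.map χ))
  map_zero' := by ext; simp
  map_add' _ _ := by ext; simp

def pull4 : C4 F →+ C4 F' where
  toFun c := fun x _ _ _ _ φ ψ χ θ => η.app x (c (T.map φ) (T.map ψ) (T.map χ) (T.map θ))
  map_zero' := by ext; simp
  map_add' _ _ := by ext; simp

lemma d0_pull (c : C0 F) : d0 F' (η.pull0 c) = η.pull1 (d0 F c) := by
  ext; simp [d0, pull0, pull1, η.naturality]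

lemma d1_pull (c : C1 F) : d1 F' (η.pull1 c) = η.pull2 (d1 F c) := by
  ext; simp [d1, pull1, pull2, η.naturality]

lemma d2_pull (c : C2 F) : d2 F' (η.pull2 c) = η.pull3 (d2 F c) := by
  ext; simp [d2, pull2, pull3, η.naturality]

lemma d3_pull (c : C3 F) : d3 F' (η.pull3 c) = η.pull4 (d3 F c) := by
  ext; simp [d3, pull3, pull4, η.naturality]

/-- The induced map on `H¹`. -/
def mapH1 : H1 F →+ H1 F' :=
  QuotientAddGroup.map _ _
    ((η.pull1.comp (d1 F).ker.subtype).codRestrict (d1 F').ker fun c => by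
      have hc : d1 F c.1 = 0 := c.2
      simp [AddMonoidHom.mem_ker, d1_pull, hc, map_zero η.pull2])
    (by
      rintro ⟨_, _⟩ ⟨b, rfl⟩
      exact ⟨η.pull0 b, η.d0_pull b⟩)

/-- The induced map on `H³`. -/
def mapH3 : H3 F →+ H3 F' :=
  QuotientAddGroup.map _ _
    ((η.pull3.comp (d3 F).ker.subtype).codRestrict (d3 F').ker fun c => by
      have hc : d3 F c.1 = 0 := c.2
      simp [AddMonoidHom.mem_ker, d3_pull, hc, map_zero η.pull4])
    (by
      rintro ⟨_, _⟩ ⟨b, rfl⟩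
      exact ⟨η.pull2 b, η.d2_pull b⟩)

end CoeffMap

end Cochain

open Cochain

/-- The constant coefficients `ℤ₂ = {±1}` (written additively). -/
def constZ2 (X : Type u) [DiffeologicalSpace X] : (EuclideanPlot X)ᵒᵖ ⥤ AddCommGrpCat.{0} :=
  (Functor.const _).obj (AddCommGrpCat.of (Additive ℤˣ))

section Twist

variable {G : Type*} [Group G] [DiffeologicalSpace G] {σ : ℤˣ →* MulAut G}
  {X : Type*} [DiffeologicalSpace X] {Y : Type*} [DiffeologicalSpace Y]

/-- Smooth sections over a Euclidean plot `p` of the bundle of groups associated with `P` and the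
action `(g, ε) ↦ χ(ε) = ±1` of `H_σ` on `M`: smooth equivariant `M`-valued functions on the
pull-back of `P` along `p`. -/
def equivariantFun (P : PrincipalBundle (HGroup σ) X) (χ : ℤˣ →* ℤˣ) (M : Type*) [AddCommGroup M]
    [DiffeologicalSpace M] [DiffeologicalAddGroup M] (p : EuclideanPlot X) :
    AddSubgroup (P.PullbackTotal p.map → M) where
  carrier := {m | DSmooth m ∧
    ∀ (h : HGroup σ) (z : P.PullbackTotal p.map), m (h • z) = ((χ h.right : ℤˣ) : ℤ) • m z}
  zero_mem' := ⟨dSmooth_const, fun _ _ => by simp⟩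
  add_mem' {a b} ha hb := ⟨fun n q hq => DiffeologicalAddGroup.smooth_add n
      (fun u => (a (q u), b (q u))) ⟨ha.1 n q hq, hb.1 n q hq⟩,
    fun h z => by simp [ha.2, hb.2, smul_add]⟩
  neg_mem' {a} ha := ⟨fun n q hq => DiffeologicalAddGroup.smooth_neg n _ (ha.1 n q hq),
    fun h z => by simp [ha.2]⟩

/-- The local system `M_α` of coefficients: the presheaf of smooth sections, over the Euclidean
plots of `X`, of the bundle with fibre `M` twisted by the `ℤ₂`-component of `P`. -/
def localSystem (P : PrincipalBundle (HGroup σ) X) (χ : ℤˣ →* ℤˣ) (M : Type*) [AddCommGroup M]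
    [DiffeologicalSpace M] [DiffeologicalAddGroup M] : (EuclideanPlot X)ᵒᵖ ⥤ AddCommGrpCat where
  obj p := AddCommGrpCat.of (equivariantFun P χ M p.unop)
  map {p q} φ := AddCommGrpCat.ofHom
    { toFun := fun m => ⟨fun z => m.1 ⟨(φ.unop.toFun z.1.1, z.1.2),
          z.2.trans (φ.unop.comm z.1.1).symm⟩,
        fun n r hr => m.2.1 n _
          (show _ ∧ _ from ⟨(φ.unop.smooth.comp hr.1.contDiff).isPlot, hr.2⟩),
        fun h z => m.2.2 h ⟨(φ.unop.toFun z.1.1, z.1.2), z.2.trans (φ.unop.comm z.1.1).symm⟩⟩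
      map_zero' := rfl
      map_add' := fun _ _ => rfl }

/-- The equivariant function underlying a section of a local system. -/
def sectionFun {P : PrincipalBundle (HGroup σ) X} {χ : ℤˣ →* ℤˣ} {M : Type*} [AddCommGroup M]
    [DiffeologicalSpace M] [DiffeologicalAddGroup M] {p : EuclideanPlot X}
    (m : (localSystem P χ M).obj (op p)) : P.PullbackTotal p.map → M :=
  Subtype.val (p := fun m => m ∈ equivariantFun P χ M p) m

/-- A bundle isomorphism `P ≅ f^*Q` induces the maps `f^* M_{α(Q)} → M_{α(P)}` of local systems. -/
def localSystemPull {P : PrincipalBundle (HGroup σ) X} {Q : PrincipalBundle (HGroup σ) Y}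
    (f : X → Y) (hf : DSmooth f) (Φ : P.Iso (Q.pullback f hf)) (χ : ℤˣ →* ℤˣ) (M : Type*)
    [AddCommGroup M] [DiffeologicalSpace M] [DiffeologicalAddGroup M] :
    CoeffMap (EuclideanPlot.push f hf) (localSystem Q χ M) (localSystem P χ M) where
  app p :=
    { toFun := fun (m : equivariantFun Q χ M _) => show equivariantFun P χ M p from
        ⟨fun z => m.1 ⟨(z.1.1, (Φ.toEquiv z.1.2).1.2),
          (Φ.toEquiv z.1.2).2.trans (congrArg f ((Φ.proj_comp z.1.2).trans z.2))⟩,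
        fun n r hr => m.2.1 n _
          (show _ ∧ _ from ⟨hr.1, (Φ.smooth_toFun n _ hr.2).2⟩),
        fun h z => by
          refine Eq.trans ?_ (m.2.2 h _)
          refine congrArg m.1 (Subtype.ext (Prod.ext rfl ?_))
          exact congrArg (fun t => t.1.2) (Φ.equivariant h z.1.2)⟩
      map_zero' := rfl
      map_add' := fun _ _ => rfl }
  naturality _ _ := rfl

/-- The pull-back `f^* : H¹(Y; ℤ₂) → H¹(X; ℤ₂)`. -/
def z2Pull (f : X → Y) (hf : DSmooth f) :
    CoeffMap (EuclideanPlot.push f hf) (constZ2 Y) (constZ2 X) where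
  app _ := AddMonoidHom.id (Additive ℤˣ)
  naturality _ _ := rfl

/-- A trivialization of `P` over all Euclidean plots: a smooth section `s_p` over each of them. -/
structure PlotSections (P : PrincipalBundle (HGroup σ) X) where
  sec : ∀ p : EuclideanPlot X, Euc p.dim → P.Total
  isPlot : ∀ p, IsPlot (sec p)
  proj_sec : ∀ p x, P.proj (sec p x) = p.map x

/-- The transition functions `h_φ = (g_φ, ε_φ)`, given by `s_p = h_φ • (s_q ∘ φ)` for `φ : p ⟶ q`.
They satisfy `h_{φ ≫ ψ} = h_φ * (h_ψ ∘ φ)`. -/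
def PlotSections.transition {P : PrincipalBundle (HGroup σ) X} (s : PlotSections P)
    {p q : EuclideanPlot X} (φ : p ⟶ q) (x : Euc p.dim) : HGroup σ :=
  P.div (y := s.sec p x) (z := s.sec q (φ.toFun x))
    ((s.proj_sec p x).trans ((φ.comm x).symm.trans (s.proj_sec q _).symm))

/-- `a` is the class `α(P)` of the cocycle `(ε_φ)` of `ℤ₂`-components of the transition functions,
for some trivialization of `P`. -/
def IsAlpha (P : PrincipalBundle (HGroup σ) X) (a : H1 (constZ2 X)) : Prop :=
  ∃ (s : PlotSections P) (c : (d1 (constZ2 X)).ker),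
    (∀ ⦃p q : EuclideanPlot X⦄ (φ : p ⟶ q) (x : Euc p.dim),
      (s.transition φ x).right = (show Additive ℤˣ from c.1 φ).toMul) ∧ a = QuotientAddGroup.mk c

/-- A central extension `1 → U(1) → Ĝ → G → 1` of diffeological groups (`incl` is an induction onto
the kernel of the subduction `quot`, with central image), together with a lift `act` to `Ĝ` of the
action `σ` of `ℤ₂` on `G`. -/
structure CircleExtension (σ : ℤˣ →* MulAut G) (Ghat : Type*) [Group Ghat]
    [DiffeologicalSpace Ghat] where
  incl : Circle →* Ghat
  quot : Ghat →* G
  act : ℤˣ →* MulAut Ghat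
  incl_injective : Function.Injective incl
  incl_induction : ∀ (n : ℕ) (z : Euc n → Circle), IsPlot z ↔ IsPlot (incl ∘ z)
  quot_subduction : IsSubduction quot
  range_incl : incl.range = quot.ker
  central : incl.range ≤ Subgroup.center Ghat
  act_smooth : ∀ ε, DSmooth (act ε)
  quot_act : ∀ ε g, quot (act ε g) = σ ε (quot g)

variable {Ghat : Type*} [Group Ghat] [DiffeologicalSpace Ghat]

open Classical in
/-- The character `χ` through which `ℤ₂` acts on the subgroup `U(1)` of `Ĝ`, as `z ↦ z ^ χ(ε)`:
trivial if the lifted action fixes `U(1)` pointwise, and `ε ↦ ε` otherwise (the only nontrivial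
smooth automorphism of `U(1)` being the inversion). -/
def CircleExtension.character (E : CircleExtension σ Ghat) : ℤˣ →* ℤˣ :=
  if ∀ ε z, E.act ε (E.incl z) = E.incl z then 1 else MonoidHom.id ℤˣ

/-- A trivialization of `P` over the Euclidean plots, with smooth lifts `ĝ_φ` to `Ĝ` of the
`G`-components `g_φ` of the transition functions. -/
structure LiftingData (E : CircleExtension σ Ghat) (P : PrincipalBundle (HGroup σ) X)
    extends PlotSections P where
  lift : ∀ ⦃p q : EuclideanPlot X⦄ (_ : p ⟶ q), Euc p.dim → Ghat
  isPlot_lift : ∀ ⦃p q : EuclideanPlot X⦄ (φ : p ⟶ q), IsPlot (lift φ)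
  quot_lift : ∀ ⦃p q : EuclideanPlot X⦄ (φ : p ⟶ q) (x : Euc p.dim),
    E.quot (lift φ x) = (toPlotSections.transition φ x).left

/-- The tautological point `(x, s_p(x))` of the pull-back of `P` along `p`. -/
def PlotSections.point {P : PrincipalBundle (HGroup σ) X} (s : PlotSections P)
    (p : EuclideanPlot X) (x : Euc p.dim) : P.PullbackTotal p.map :=
  ⟨(x, s.sec p x), s.proj_sec p x⟩

/-- The local system `U(1)_{α(P)}`. -/
abbrev circleSystem (E : CircleExtension σ Ghat) (P : PrincipalBundle (HGroup σ) X) :=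
  localSystem P E.character (Additive Circle)

/-- The local system `ℝ_{α(P)}`. -/
abbrev realSystem (E : CircleExtension σ Ghat) (P : PrincipalBundle (HGroup σ) X) :=
  localSystem P E.character ℝ

/-- The local system `ℤ_{α(P)}`. -/
abbrev intSystem (E : CircleExtension σ Ghat) (P : PrincipalBundle (HGroup σ) X) :=
  localSystem P E.character ℤ

/-- `b` is the obstruction class `β(P)` of the lifting gerbe: it is represented by a cocycle whose
coordinates in some trivialization are
`a_{φ,ψ} = ĝ_φ * σ̂^{ε_φ}(ĝ_ψ ∘ φ) * ĝ_{φ ≫ ψ}⁻¹`, for some smooth lifts `ĝ`. -/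
def IsBeta (E : CircleExtension σ Ghat) (P : PrincipalBundle (HGroup σ) X)
    (b : H2 (circleSystem E P)) : Prop :=
  ∃ (L : LiftingData E P) (a : (d2 (circleSystem E P)).ker),
    (∀ ⦃p q r : EuclideanPlot X⦄ (φ : p ⟶ q) (ψ : q ⟶ r) (x : Euc p.dim),
      E.incl (sectionFun (a.1 φ ψ) (L.point p x)).toMul =
        L.lift φ x * E.act (L.transition φ x).right (L.lift ψ (φ.toFun x)) *
          (L.lift (φ ≫ ψ) x)⁻¹) ∧
    b = QuotientAddGroup.mk a

/-- `d` is the image of `b` under the connecting morphism `H²(X; U(1)_α) → H³(X; ℤ_α)` of the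
twisted exponential sequence `0 → ℤ_α → ℝ_α → U(1)_α → 0`, `t ↦ exp (2π i t)`: for a cocycle `a`
representing `b` and a real cochain `r` with `exp (2π i r) = a`, the cocycle `n` representing `d` is
the coboundary of `r`. -/
def IsConnecting (E : CircleExtension σ Ghat) (P : PrincipalBundle (HGroup σ) X)
    (b : H2 (circleSystem E P)) (d : H3 (intSystem E P)) : Prop :=
  ∃ (a : (d2 (circleSystem E P)).ker) (r : C2 (realSystem E P)) (n : (d3 (intSystem E P)).ker),
    (∀ ⦃p q s : EuclideanPlot X⦄ (φ : p ⟶ q) (ψ : q ⟶ s) (z : P.PullbackTotal p.map),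
      Circle.exp (2 * Real.pi * sectionFun (r φ ψ) z) = (sectionFun (a.1 φ ψ) z).toMul) ∧
    (∀ ⦃p q s t : EuclideanPlot X⦄ (φ : p ⟶ q) (ψ : q ⟶ s) (χ : s ⟶ t)
      (z : P.PullbackTotal p.map),
      sectionFun (d2 (realSystem E P) r φ ψ χ) z = ((sectionFun (n.1 φ ψ χ) z : ℤ) : ℝ)) ∧
    b = QuotientAddGroup.mk a ∧ d = QuotientAddGroup.mk n

/-- The group in which twisting data live: `H¹(X; ℤ₂) × H³(X; ℤ_{α(P)})`. -/
abbrev TwistGroup (E : CircleExtension σ Ghat) (P : PrincipalBundle (HGroup σ) X) :=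
  H1 (constZ2 X) × H3 (intSystem E P)

/-- `t` is the pair `(α(P), DD_α(P))`, where `DD_α(P)` is the image of `β(P)` under the connecting
morphism. -/
def IsTwistingDatum (E : CircleExtension σ Ghat) (P : PrincipalBundle (HGroup σ) X)
    (t : TwistGroup E P) : Prop :=
  IsAlpha P t.1 ∧ ∃ b, IsBeta E P b ∧ IsConnecting E P b t.2

/-- The spherical twisting datum `τ(P) = (α(P), DD_α(P))`. -/
def twistingDatum (E : CircleExtension σ Ghat) (P : PrincipalBundle (HGroup σ) X) :
    TwistGroup E P :=
  Classical.epsilon (IsTwistingDatum E P)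

/-- The pull-back of twisting data along `f`, the local system of `P` being identified with the
pull-back of that of `Q` by the bundle isomorphism `Φ : P ≅ f^*Q`. -/
def twistPull (E : CircleExtension σ Ghat) {P : PrincipalBundle (HGroup σ) X}
    {Q : PrincipalBundle (HGroup σ) Y} (f : X → Y) (hf : DSmooth f)
    (Φ : P.Iso (Q.pullback f hf)) : TwistGroup E Q →+ TwistGroup E P :=
  (z2Pull f hf).mapH1.prodMap (localSystemPull f hf Φ E.character ℤ).mapH3

end Twist

end SphericalTwist

end

open SphericalTwist

noncomputable section

namespace SphericalTwist

/-! ### Smooth sections over Euclidean spaces -/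

/-! The argument has two halves: the twisting datum of any bundle exists and is unique, and a
pulled-back twisting datum is a twisting datum. Two twisting data of `P`, namely `τ(P)` and the
pull-back of the universal one, must then coincide.

Existence rests on one fact, `exists_section`: a principal bundle pulled back to `ℝⁿ` has a global
smooth section. It is applied to three bundles. For `P` it gives the sections `s_p`. For `Ĝ → G`,
viewed as a principal `U(1)`-bundle, it gives the lifts `ĝ_φ`. For `ℝ → U(1)`, viewed as a principal
`ℤ`-bundle, it gives logarithms, so the exponential sequence of local systems is exact on every
Euclidean plot and the connecting morphism is the usual diagram chase on cochains.

The cocycle condition for `β`, and its independence of choices, are associativity in `Ĝ ⋊ ℤ₂`. The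
elements `(ĝ_φ, ε_φ)` are multiplicative up to `U(1)`, and moving an element of `U(1)` to the left
past one with sign `ε` raises it to the power `χ(ε)` (`mul_inclHat`). Restricting a section of the
local system along `φ` costs the same sign (`sectionFun_map_point`), so the twisted differential is
what associativity produces. That `ℤ₂` acts on `U(1)` through `χ` follows from the classification of
smooth involutions of the circle.

For naturality, a plot `p` of the base of `P` yields the plot `f ∘ p`, and `Φ` carries sections of
`Q` over `f ∘ p` to sections of `P` over `p` with the same transition functions. The same lifts,
logarithms and integer cochains then serve for `P`. -/

/-- The closed box with lower corner `a` and upper corner `b`. -/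
def box {n : ℕ} (a b : Fin n → ℝ) : Set (Euc n) := {x | ∀ i, a i ≤ x i ∧ x i ≤ b i}

lemma box_mono {n : ℕ} {a b a' b' : Fin n → ℝ} (ha : ∀ i, a' i ≤ a i) (hb : ∀ i, b i ≤ b' i) :
    box a b ⊆ box a' b' :=
  fun _ hx i => ⟨(ha i).trans (hx i).1, (hx i).2.trans (hb i)⟩

/-- Compactness of the box gives a uniform margin. The distance is measured in `Fin n → ℝ`, whose
sup norm makes a thickened box a larger box. -/
lemma exists_thickened_box_subset {n : ℕ} {a b : Fin n → ℝ} (hab : ∀ i, a i ≤ b i)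
    {U : Set (Euc n)} (hU : IsOpen U) (h : box a b ⊆ U) :
    ∃ δ > 0, ∀ y : Euc n, (∀ i, a i - δ < y i ∧ y i < b i + δ) → y ∈ U := by
  have hU' : IsOpen ((WithLp.toLp 2 : (Fin n → ℝ) → Euc n) ⁻¹' U) :=
    hU.preimage (PiLp.continuous_toLp 2 _)
  have hK : Set.Icc a b ⊆ (WithLp.toLp 2 : (Fin n → ℝ) → Euc n) ⁻¹' U :=
    fun x hx => h fun i => ⟨hx.1 i, hx.2 i⟩
  obtain ⟨δ, hδ, hsub⟩ := isCompact_Icc.exists_thickening_subset_open hU' hK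
  refine ⟨δ, hδ, fun y hy => ?_⟩
  have hmem : (fun i => y i) ∈ Metric.thickening δ (Set.Icc a b) := by
    -- The nearby point of the box is `y` with each coordinate clamped to `[a i, b i]`.
    refine Metric.mem_thickening_iff.2 ⟨fun i => max (a i) (min (b i) (y i)),
      ⟨fun i => le_max_left _ _, fun i => max_le (hab i) (min_le_left _ _)⟩, ?_⟩
    refine (dist_pi_lt_iff hδ).2 fun i => ?_
    rw [Real.dist_eq, abs_lt]
    obtain ⟨h1, h2⟩ := hy i
    have := hab i
    rcases le_total (b i) (y i) with h3 | h3 <;> rcases le_total (a i) (y i) with h4 | h4 <;>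
      simp [h3, h4, this] <;> first | exact hδ | (constructor <;> linarith)
  exact hsub hmem

/-- A smooth self-map of `ℝ` with values in `(a - δ, b + δ)` which is the identity near `[a, b]`. -/
lemma exists_smooth_retract_Icc {a b δ : ℝ} (hab : a ≤ b) (hδ : 0 < δ) :
    ∃ f : ℝ → ℝ, ContDiff ℝ ∞ f ∧ (∀ y, a - δ < f y ∧ f y < b + δ) ∧
      ∀ x ∈ Set.Icc a b, f =ᶠ[𝓝 x] id := by
  -- Around the midpoint the bump is `1` up to half the length plus `δ / 2`, hence near `[a, b]`,
  -- and vanishes beyond half the length plus `δ`, so the damped displacement never reaches that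
  -- bound.
  let c : ContDiffBump ((a + b) / 2) :=
    ⟨(b - a) / 2 + δ / 2, (b - a) / 2 + δ, by linarith, by linarith⟩
  refine ⟨fun y => (a + b) / 2 + c y * (y - (a + b) / 2), ?_, fun y => ?_, fun x hx => ?_⟩
  · exact contDiff_const.add (c.contDiff.mul (contDiff_id.sub contDiff_const))
  · have h : |c y * (y - (a + b) / 2)| < (b - a) / 2 + δ := by
      rw [abs_mul, abs_of_nonneg c.nonneg]
      by_cases hy : dist y ((a + b) / 2) < (b - a) / 2 + δ
      · rw [Real.dist_eq] at hy
        calc c y * |y - (a + b) / 2| ≤ 1 * |y - (a + b) / 2| := by gcongr; exact c.le_one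
          _ < _ := by simpa using hy
      · have : c y = 0 := c.zero_of_le_dist (not_lt.1 hy)
        rw [this, zero_mul]
        linarith
    have := abs_lt.1 h
    constructor <;> linarith
  · have hmem : x ∈ Metric.ball ((a + b) / 2) c.rIn := by
      rw [Metric.mem_ball, Real.dist_eq, abs_lt]
      have h1 := hx.1
      have h2 := hx.2
      change -((b - a) / 2 + δ / 2) < _ ∧ _ < (b - a) / 2 + δ / 2
      constructor <;> linarith
    filter_upwards [Metric.isOpen_ball.mem_nhds hmem] with y hy
    simp [c.one_of_mem_closedBall (Metric.ball_subset_closedBall hy)]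

/-- A smooth self-map of `ℝⁿ` with values in a given neighbourhood of a box, which is the identity
near the box. -/
lemma exists_smooth_retract_box {n : ℕ} {a b : Fin n → ℝ} (hab : ∀ i, a i ≤ b i)
    {U : Set (Euc n)} (hU : IsOpen U) (h : box a b ⊆ U) :
    ∃ f : Euc n → Euc n, ContDiff ℝ ∞ f ∧ (∀ y, f y ∈ U) ∧ ∀ x ∈ box a b, f =ᶠ[𝓝 x] id := by
  obtain ⟨δ, hδ, hsub⟩ := exists_thickened_box_subset hab hU h
  choose f hf hfm hfe using fun i => exists_smooth_retract_Icc (hab i) hδ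
  refine ⟨fun y => WithLp.toLp 2 fun i => f i (y i), ?_, fun y => hsub _ fun i => hfm i (y i),
    fun x hx => ?_⟩
  · refine contDiff_euclidean.2 fun i => (hf i).comp ?_
    exact contDiff_euclidean.1 contDiff_id i
  · have hi : ∀ i, ∀ᶠ y : Euc n in 𝓝 x, f i (y i) = y i := fun i =>
      (show Continuous fun y : Euc n => y i by fun_prop).continuousAt.eventually (hfe i _ (hx i))
    filter_upwards [Filter.eventually_all.2 hi] with y hy
    ext i
    simp [hy i]

/-! ### Triviality of principal bundles over Euclidean spaces -/

namespace PrincipalBundle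

universe u v w

variable {H : Type u} [Group H] [DiffeologicalSpace H] {X : Type v} [DiffeologicalSpace X]
  (P : PrincipalBundle.{u, v, w} H X) {n : ℕ} (p : Euc n → X)

lemma eq_div_smul {y z : P.Total} (h : P.proj y = P.proj z) : y = P.div h • z :=
  (P.free_transitive y z h).choose_spec.1

lemma div_eq {y z : P.Total} (h : P.proj y = P.proj z) {k : H} (hk : y = k • z) : P.div h = k :=
  ((P.free_transitive y z h).choose_spec.2 k hk).symm

lemma smul_left_cancel' {z : P.Total} {k l : H} (h : k • z = l • z) : k = l :=
  (P.free_transitive (k • z) z (P.proj_smul k z)).unique rfl h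

lemma isPlot_smul {h : Euc n → H} {z : Euc n → P.Total} (hh : IsPlot h) (hz : IsPlot z) :
    IsPlot fun x => h x • z x :=
  P.smooth_smul n (fun x => (h x, z x)) ⟨hh, hz⟩

/-- Near `x`, the map `s` is a smooth section of `P` over `p`. -/
def IsSectionAt (s : Euc n → P.Total) (x : Euc n) : Prop :=
  (∃ q : Euc n → P.Total, IsPlot q ∧ s =ᶠ[𝓝 x] q) ∧ ∀ᶠ y in 𝓝 x, P.proj (s y) = p y

variable {P p}

lemma IsSectionAt.congr {s t : Euc n → P.Total} {x : Euc n} (hs : P.IsSectionAt p s x)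
    (h : t =ᶠ[𝓝 x] s) : P.IsSectionAt p t x := by
  obtain ⟨⟨q, hq, hsq⟩, hp⟩ := hs
  refine ⟨⟨q, hq, h.trans hsq⟩, ?_⟩
  filter_upwards [h, hp] with y h1 h2
  rw [h1, h2]

lemma isOpen_isSectionAt (s : Euc n → P.Total) : IsOpen {x | P.IsSectionAt p s x} := by
  refine isOpen_iff_mem_nhds.2 ?_
  rintro x ⟨⟨q, hq, hsq⟩, hp⟩
  filter_upwards [eventually_eventually_nhds.2 hsq, eventually_eventually_nhds.2 hp] with y h1 h2
  exact ⟨⟨q, hq, h1⟩, h2⟩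

/-- Plots here are defined on all of `ℝⁿ`, so a section cannot simply be restricted to an open set.
Composing with a smooth map into the region where it is a section replaces the restriction. -/
lemma isPlot_comp_of_isSectionAt {s : Euc n → P.Total} {r : Euc n → Euc n}
    (hr : ContDiff ℝ ∞ r) (h : ∀ y, P.IsSectionAt p s (r y)) : IsPlot (s ∘ r) := by
  refine isPlot_of_nhds fun x => ?_
  obtain ⟨⟨q, hq, hsq⟩, -⟩ := h x
  exact ⟨q ∘ r, isPlot_reparam hq hr, hr.continuous.continuousAt.eventually hsq⟩

/-- A section near a set can be modified so as to agree with a given section near a box. -/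
lemma exists_section_eq_near_box {a b : Fin n → ℝ} (hab : ∀ i, a i ≤ b i) {K : Set (Euc n)}
    {s t : Euc n → P.Total} (hs : ∀ x ∈ box a b, P.IsSectionAt p s x)
    (ht : ∀ x ∈ box a b, P.IsSectionAt p t x) (htK : ∀ x ∈ K, P.IsSectionAt p t x) :
    ∃ t' : Euc n → P.Total, (∀ x ∈ K, P.IsSectionAt p t' x) ∧ ∀ x ∈ box a b, t' =ᶠ[𝓝 x] s := by
  classical
  have hU : IsOpen ({x | P.IsSectionAt p s x} ∩ {x | P.IsSectionAt p t x}) :=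
    (isOpen_isSectionAt s).inter (isOpen_isSectionAt t)
  have hsub : box a b ⊆ {x | P.IsSectionAt p s x} ∩ {x | P.IsSectionAt p t x} :=
    fun x hx => ⟨hs x hx, ht x hx⟩
  obtain ⟨r, hr, hrU, hre⟩ := exists_smooth_retract_box hab hU hsub
  -- The ratio of the two sections where they lie in the same fibre; the value `1` elsewhere is
  -- never used.
  let h : Euc n → H := fun y => if e : P.proj (s y) = P.proj (t y) then P.div e else 1
  have hst : ∀ y ∈ {x | P.IsSectionAt p s x} ∩ {x | P.IsSectionAt p t x}, h y • t y = s y := by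
    intro y hy
    have e : P.proj (s y) = P.proj (t y) := hy.1.2.self_of_nhds.trans hy.2.2.self_of_nhds.symm
    simp only [h, dif_pos e]
    exact (P.eq_div_smul e).symm
  have hplot : IsPlot (h ∘ r) := by
    refine P.smooth_div n (h ∘ r) (t ∘ r) (isPlot_comp_of_isSectionAt hr fun y => (hrU y).2) ?_
    have : (fun x => (h ∘ r) x • (t ∘ r) x) = s ∘ r := funext fun x => hst _ (hrU x)
    rw [this]
    exact isPlot_comp_of_isSectionAt hr fun y => (hrU y).1
  -- The ratio `h` is controlled only near the box, but `h ∘ r` is smooth on all of `ℝⁿ`.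
  -- Translating `t` by it therefore keeps `t` a section on `K`, and near the box, where `r` is the
  -- identity, turns it into `s`.
  refine ⟨fun y => h (r y) • t y, fun x hx => ?_, fun x hx => ?_⟩
  · obtain ⟨⟨q, hq, htq⟩, hp⟩ := htK x hx
    refine ⟨⟨fun y => h (r y) • q y, P.isPlot_smul hplot hq, ?_⟩, ?_⟩
    · filter_upwards [htq] with y hy
      rw [hy]
    · filter_upwards [hp] with y hy
      rw [P.proj_smul, hy]
  · filter_upwards [hre x hx, hU.mem_nhds (hsub hx)] with y h1 h2
    rw [h1]
    exact hst y h2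

/-- The half-boxes meet in the face `x i = c`, itself a degenerate box. Once the second section
agrees with the first near the whole face, the piecewise definition is smooth across it. -/
lemma exists_section_glue {a b : Fin n → ℝ} (hab : ∀ i, a i ≤ b i) {i : Fin n} {c : ℝ}
    (hac : a i ≤ c) (hcb : c ≤ b i)
    (h1 : ∃ s : Euc n → P.Total, ∀ x ∈ box a (Function.update b i c), P.IsSectionAt p s x)
    (h2 : ∃ s : Euc n → P.Total, ∀ x ∈ box (Function.update a i c) b, P.IsSectionAt p s x) :
    ∃ s : Euc n → P.Total, ∀ x ∈ box a b, P.IsSectionAt p s x := by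
  obtain ⟨s, hs⟩ := h1
  obtain ⟨t, ht⟩ := h2
  have hF : ∀ j, Function.update a i c j ≤ Function.update b i c j := by
    intro j
    by_cases hj : j = i
    · subst hj; simp
    · simpa [hj] using hab j
  have ha : ∀ j, a j ≤ Function.update a i c j := by
    intro j
    by_cases hj : j = i
    · subst hj; simpa
    · simp [hj]
  have hb : ∀ j, Function.update b i c j ≤ b j := by
    intro j
    by_cases hj : j = i
    · subst hj; simpa
    · simp [hj]
  obtain ⟨t', ht', hts⟩ := exists_section_eq_near_box hF
    (fun x hx => hs x (box_mono ha (fun _ => le_rfl) hx))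
    (fun x hx => ht x (box_mono (fun _ => le_rfl) hb hx)) ht
  refine ⟨fun y => if y i ≤ c then s y else t' y, fun x hx => ?_⟩
  have hcont : Continuous fun y : Euc n => y i := by fun_prop
  rcases lt_trichotomy (x i) c with h | h | h
  · refine (hs x fun j => ⟨(hx j).1, ?_⟩).congr ?_
    · by_cases hj : j = i
      · subst hj; simpa using h.le
      · simpa [hj] using (hx j).2
    · filter_upwards [hcont.continuousAt.eventually (gt_mem_nhds h)] with y hy
      simp [le_of_lt hy]
  · have hxF : x ∈ box (Function.update a i c) (Function.update b i c) := by
      intro j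
      by_cases hj : j = i
      · subst hj; simp [h]
      · simpa [hj] using hx j
    refine (hs x (box_mono ha (fun _ => le_rfl) hxF)).congr ?_
    filter_upwards [hts x hxF] with y hy
    simp [hy]
  · refine (ht' x fun j => ⟨?_, (hx j).2⟩).congr ?_
    · by_cases hj : j = i
      · subst hj; simpa using h.le
      · simpa [hj] using (hx j).1
    · filter_upwards [hcont.continuousAt.eventually (lt_mem_nhds h)] with y hy
      simp [not_le.2 hy]

/-- Induction on the set `S` of directions in which the box may have positive length. A single point
is covered by a local lift. In a further direction `i`, every slice has a section by induction, this
section survives on a slab around the slice, and finitely many slabs are glued successively. -/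
lemma exists_section_box (hp : IsPlot p) (S : Finset (Fin n)) :
    ∀ a b : Fin n → ℝ, (∀ i ∉ S, a i = b i) → (∀ i, a i ≤ b i) →
      ∃ s : Euc n → P.Total, ∀ x ∈ box a b, P.IsSectionAt p s x := by
  induction S using Finset.induction_on with
  | empty =>
    intro a b hab _
    obtain ⟨q, hq, hpq⟩ := P.subduction.lifts n p hp (WithLp.toLp 2 a)
    refine ⟨q, fun x hx => ?_⟩
    have : x = WithLp.toLp 2 a := by
      ext i
      have := hx i
      rw [← hab i (by simp)] at this
      exact le_antisymm this.2 this.1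
    subst this
    exact ⟨⟨q, hq, Filter.EventuallyEq.rfl⟩, hpq.mono fun y hy => hy.symm⟩
  | insert i S hi ih =>
    intro a b hS hab
    have hmix : ∀ {u v : ℝ}, u ≤ v → ∀ j, Function.update a i u j ≤ Function.update b i v j := by
      intro u v huv j
      by_cases hj : j = i
      · subst hj; simpa
      · simpa [hj] using hab j
    have key : ∀ t : ℝ, ∃ ε > 0, ∀ u v, t - ε < u → v < t + ε →
        ∃ s : Euc n → P.Total, ∀ x ∈ box (Function.update a i u) (Function.update b i v),
          P.IsSectionAt p s x := by
      intro t
      obtain ⟨s, hs⟩ := ih (Function.update a i t) (Function.update b i t) (fun j hj => by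
        by_cases h : j = i
        · subst h; simp
        · simpa [h] using hS j (by simp [h, hj])) (hmix le_rfl)
      obtain ⟨ε, hε, hsub⟩ := exists_thickened_box_subset (hmix le_rfl) (isOpen_isSectionAt s) hs
      refine ⟨ε, hε, fun u v hu hv => ⟨s, fun x hx => hsub x fun j => ?_⟩⟩
      have := hx j
      by_cases h : j = i
      · subst h
        simp only [Function.update_self] at this ⊢
        constructor <;> linarith
      · simp only [Function.update_of_ne h] at this ⊢
        constructor <;> linarith
    choose ε hε hεs using key
    -- A subdivision of `[a i, b i]` each of whose segments lies in the slab of some slice `τ`; the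
    -- sequence equals `b i` from index `m` on.
    obtain ⟨t, ht0, htm, ⟨m, hm⟩, hts⟩ := exists_monotone_Icc_subset_open_cover_Icc (hab i)
      (c := fun t : ℝ => (Subtype.val : Set.Icc (a i) (b i) → ℝ) ⁻¹' Set.Ioo (t - ε t) (t + ε t))
      (fun t => isOpen_Ioo.preimage continuous_subtype_val)
      (fun x _ => Set.mem_iUnion.2 ⟨x.1, by simp [hε]⟩)
    have hseg : ∀ k : ℕ, ∃ s : Euc n → P.Total,
        ∀ x ∈ box a (Function.update b i (t k)), P.IsSectionAt p s x := by
      intro k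
      induction k with
      | zero =>
        have := hεs (a i) (a i) (a i) (by linarith [hε (a i)]) (by linarith [hε (a i)])
        rw [Function.update_eq_self] at this
        rwa [ht0]
      | succ k ihk =>
        obtain ⟨τ, hτ⟩ := hts k
        have hle := htm (Nat.le_succ k)
        have hl := hτ (Set.left_mem_Icc.2 hle)
        have hr := hτ (Set.right_mem_Icc.2 hle)
        refine exists_section_glue (i := i) (c := t k) ?_ (t k).2.1 ?_ ?_ ?_
        · have := hmix (u := a i) (t (k + 1)).2.1
          rwa [Function.update_eq_self] at this
        · simpa using hle
        · rwa [Function.update_idem]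
        · exact hεs τ _ _ hl.1 hr.2
    have := hseg m
    rwa [hm m le_rfl, Function.update_eq_self] at this

/-- Principal bundles over a Euclidean space are trivial: every plot of the base space lifts to the
total space. -/
theorem exists_section (P : PrincipalBundle.{u, v, w} H X) (hp : IsPlot p) :
    ∃ s : Euc n → P.Total, IsPlot s ∧ ∀ x, P.proj (s x) = p x := by
  let B : ℕ → Set (Euc n) := fun k => box (fun _ => -(k : ℝ)) fun _ => (k : ℝ)
  have hB : ∀ k, ∃ s : Euc n → P.Total, ∀ x ∈ B k, P.IsSectionAt p s x := fun k =>
    exists_section_box hp Finset.univ _ _ (by simp) fun _ => by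
      have : (0 : ℝ) ≤ k := k.cast_nonneg
      linarith
  have hBm : ∀ {k l : ℕ}, k ≤ l → B k ⊆ B l := fun {k l} h =>
    box_mono (fun _ => neg_le_neg (by exact_mod_cast h)) fun _ => by exact_mod_cast h
  -- A section near one cube is continued to the next without changing it on the smaller cube, so
  -- the successive sections have a limit.
  have step : ∀ k (s : Euc n → P.Total), (∀ x ∈ B k, P.IsSectionAt p s x) →
      ∃ t : Euc n → P.Total, (∀ x ∈ B (k + 1), P.IsSectionAt p t x) ∧ ∀ x ∈ B k, t x = s x := by
    intro k s hs
    obtain ⟨t, ht⟩ := hB (k + 1)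
    obtain ⟨t', h1, h2⟩ := exists_section_eq_near_box (fun _ => by
      have : (0 : ℝ) ≤ k := k.cast_nonneg
      linarith) hs (fun x hx => ht x (hBm k.le_succ hx)) ht
    exact ⟨t', h1, fun x hx => (h2 x hx).self_of_nhds⟩
  choose! next hnext hnexteq using step
  let S : ℕ → Euc n → P.Total := fun k => Nat.rec (hB 0).choose next k
  have hS : ∀ k, ∀ x ∈ B k, P.IsSectionAt p (S k) x := by
    intro k
    induction k with
    | zero => exact (hB 0).choose_spec
    | succ k ih => exact hnext k _ ih
  have hSeq : ∀ k l, k ≤ l → ∀ x ∈ B k, S l x = S k x := by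
    intro k l h
    induction l, h using Nat.le_induction with
    | base => exact fun _ _ => rfl
    | succ l hkl ih => exact fun x hx => (hnexteq l _ (hS l) x (hBm hkl hx)).trans (ih x hx)
  have hmem : ∀ (x : Euc n) (k : ℕ), ‖x‖ ≤ k → x ∈ B k := fun x k h i =>
    abs_le.1 (((Real.norm_eq_abs _).symm.le.trans (PiLp.norm_apply_le x i)).trans h)
  -- Coordinates are bounded by the norm, so `x` lies in the cube with this index and the sequence
  -- is constant at `x` from there on.
  let s : Euc n → P.Total := fun x => S ⌈‖x‖⌉₊ x
  have hs : ∀ x, P.IsSectionAt p s x := by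
    intro x
    obtain ⟨k, hk⟩ := exists_nat_gt ‖x‖
    refine (hS k x (hmem x k hk.le)).congr ?_
    filter_upwards [continuous_norm.continuousAt.eventually (gt_mem_nhds hk)] with y hy
    exact (hSeq _ _ (Nat.ceil_le.2 (le_of_lt hy)) y (hmem y _ (Nat.le_ceil _))).symm
  exact ⟨s, isPlot_of_nhds fun x => (hs x).1, fun x => (hs x).2.self_of_nhds⟩

end PrincipalBundle

/-! ### Lifting circle-valued functions and smooth automorphisms of the circle -/

lemma isLocallyConstant_of_continuous_cast {T : Type*} [TopologicalSpace T] {k : T → ℤ}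
    (h : Continuous fun t => (k t : ℝ)) : IsLocallyConstant k :=
  (IsLocallyConstant.iff_continuous k).2
    (Int.isClosedEmbedding_coe_real.isEmbedding.continuous_iff.2 h)

lemma exp_two_pi_eq_one_iff {t : ℝ} : Circle.exp (2 * Real.pi * t) = 1 ↔ ∃ k : ℤ, t = k := by
  rw [Circle.exp_eq_one]
  have := Real.two_pi_pos.ne'
  refine exists_congr fun k => ?_
  rw [mul_comm (k : ℝ), mul_right_inj' this]

lemma exp_two_pi_eq_iff {s t : ℝ} :
    Circle.exp (2 * Real.pi * s) = Circle.exp (2 * Real.pi * t) ↔ ∃ k : ℤ, s - t = k := by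
  rw [← exp_two_pi_eq_one_iff, mul_sub, Circle.exp_sub, div_eq_one]

lemma isPlot_exp_two_pi {n : ℕ} {r : Euc n → ℝ} (hr : ContDiff ℝ ∞ r) :
    IsPlot fun x => Circle.exp (2 * Real.pi * r x) := by
  refine isPlot_circle_iff.2 ?_
  simp only [Circle.coe_exp]
  refine (Complex.contDiff_exp (𝕜 := ℝ)).comp (ContDiff.mul ?_ contDiff_const)
  exact Complex.ofRealCLM.contDiff.comp (contDiff_const.mul hr)

lemma isPlot_circle_mul_const {n : ℕ} {p : Euc n → Circle} (hp : IsPlot p) (z : Circle) :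
    IsPlot fun x => p x * z := by
  have h : ContDiff ℝ ∞ fun u => (p u : ℂ) := hp
  refine isPlot_circle_iff.2 ?_
  simpa using h.mul contDiff_const

instance : DiffeologicalSpace (Multiplicative ℤ) := discreteDiffeology _

/-- Rotation by `(p x)⁻¹` moves the value at `x` to `1`, into the slit plane where the complex
logarithm is smooth. The retraction `g` keeps all values there, and `arg (p x)` undoes the rotation.
-/
lemma exists_local_circle_lift {n : ℕ} {p : Euc n → Circle} (hp : IsPlot p) (x : Euc n) :
    ∃ q : Euc n → ℝ, IsPlot q ∧ p =ᶠ[𝓝 x] fun u => Circle.exp (2 * Real.pi * q u) := by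
  let w : Euc n → Circle := fun u => p u * (p x)⁻¹
  have hw : ContDiff ℝ ∞ fun u => (w u : ℂ) := isPlot_circle_mul_const hp _
  have hopen : IsOpen {u | (w u : ℂ) ∈ Complex.slitPlane} :=
    Complex.isOpen_slitPlane.preimage hw.continuous
  have hx : x ∈ {u | (w u : ℂ) ∈ Complex.slitPlane} := by simp [w]
  obtain ⟨g, hg, hgs, hgx⟩ := exists_smooth_retract x hopen hx
  refine ⟨fun u => (Complex.arg (w (g u)) + Complex.arg (p x)) / (2 * Real.pi), ?_, ?_⟩
  · have hlog : ContDiff ℝ ∞ fun u => Complex.log (w (g u) : ℂ) := by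
      refine contDiff_iff_contDiffAt.2 fun u => ?_
      have h : ContDiffAt ℝ ∞ Complex.log (w (g u) : ℂ) :=
        (Complex.contDiffAt_log (hgs u)).restrict_scalars ℝ
      exact h.comp u (hw.comp hg).contDiffAt
    have harg : ContDiff ℝ ∞ fun u => Complex.arg (w (g u) : ℂ) := by
      simp only [← Complex.log_im]
      exact Complex.imCLM.contDiff.comp hlog
    exact ((harg.add contDiff_const).div_const _).isPlot
  · filter_upwards [hgx] with u hu
    rw [mul_div_cancel₀ _ Real.two_pi_pos.ne', Circle.exp_add, Circle.exp_arg, Circle.exp_arg, hu]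
    simp [w]

/-- The principal `ℤ`-bundle `t ↦ exp (2π i t)` over the circle. -/
def expBundle : PrincipalBundle (Multiplicative ℤ) Circle where
  Total := ℝ
  action :=
    { smul := fun k t => (k.toAdd : ℝ) + t
      one_smul := fun t => show ((0 : ℤ) : ℝ) + t = t by simp
      mul_smul := fun k l t =>
        show ((k.toAdd + l.toAdd : ℤ) : ℝ) + t = k.toAdd + (l.toAdd + t) by push_cast; ring }
  proj t := Circle.exp (2 * Real.pi * t)
  subduction :=
    { smooth := fun _ _ hp => isPlot_exp_two_pi hp.contDiff
      surjective := fun z => ⟨Complex.arg z / (2 * Real.pi), by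
        beta_reduce
        rw [mul_div_cancel₀ _ Real.two_pi_pos.ne', Circle.exp_arg]⟩
      lifts := fun _ _ hp x => exists_local_circle_lift hp x }
  proj_smul k t := exp_two_pi_eq_iff.2 ⟨k.toAdd, show (k.toAdd : ℝ) + t - t = _ by ring⟩
  smooth_smul n p hp := by
    have h1 : IsLocallyConstant fun u => (p u).1 := hp.1
    have h2 : ContDiff ℝ ∞ fun u => (p u).2 := IsPlot.contDiff hp.2
    refine isPlot_of_nhds fun x => ⟨fun u => ((p x).1.toAdd : ℝ) + (p u).2,
      (contDiff_const.add h2).isPlot, ?_⟩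
    filter_upwards [(IsLocallyConstant.iff_eventually_eq _).1 h1 x] with u hu
    change ((p u).1.toAdd : ℝ) + _ = _
    rw [hu]
  free_transitive s t h := by
    obtain ⟨k, hk⟩ := exp_two_pi_eq_iff.1 h
    refine ⟨Multiplicative.ofAdd k, show s = (k : ℝ) + t by linarith, fun l hl => ?_⟩
    have hl' : s = (l.toAdd : ℝ) + t := hl
    have : (l.toAdd : ℝ) = k := by linarith
    exact_mod_cast this
  smooth_div n h z hz hhz := by
    have h1 : ContDiff ℝ ∞ z := IsPlot.contDiff hz
    have h2 : ContDiff ℝ ∞ fun x => ((h x).toAdd : ℝ) + z x := IsPlot.contDiff hhz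
    have h3 : IsLocallyConstant fun x => (h x).toAdd :=
      isLocallyConstant_of_continuous_cast (by simpa using (h2.sub h1).continuous)
    exact h3

/-- Smooth circle-valued functions on a Euclidean space have smooth logarithms. -/
lemma exists_circle_lift {n : ℕ} {p : Euc n → Circle} (hp : IsPlot p) :
    ∃ r : Euc n → ℝ, ContDiff ℝ ∞ r ∧ ∀ x, Circle.exp (2 * Real.pi * r x) = p x := by
  obtain ⟨r, hr, hrp⟩ := expBundle.exists_section hp
  have hr' : @IsPlot ℝ _ n r := hr
  exact ⟨r, hr'.contDiff, hrp⟩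

/-- A smooth involutive endomorphism of the circle is the identity or the inversion. -/
lemma circle_involution {θ : Circle →* Circle} (hθ : DSmooth θ) (hinv : ∀ z, θ (θ z) = z) :
    (∀ z, θ z = z) ∨ ∀ z, θ z = z⁻¹ := by
  have hexp : ∀ z : Circle, ∃ t : ℝ, Circle.exp (2 * Real.pi * t) = z :=
    expBundle.subduction.surjective
  have hid : ContDiff ℝ ∞ fun u : Euc 1 => u 0 := contDiff_euclidean.1 contDiff_id 0
  -- A lift of `θ` to the universal cover; `Euc 1` stands in for `ℝ`, since lifting is available for
  -- plots on `Euc n`.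
  obtain ⟨r, hr, hrθ⟩ := exists_circle_lift (hθ 1 _ (isPlot_exp_two_pi hid))
  let ρ : ℝ → ℝ := fun t => r (WithLp.toLp 2 fun _ => t)
  have hρc : Continuous ρ := hr.continuous.comp
    ((PiLp.continuous_toLp 2 _).comp (continuous_pi fun _ => continuous_id))
  have hρ : ∀ t, Circle.exp (2 * Real.pi * ρ t) = θ (Circle.exp (2 * Real.pi * t)) :=
    fun t => hrθ _
  have hk : ∀ s t, ∃ k : ℤ, ρ (t + s) - ρ t - ρ s = k := by
    intro s t
    refine exp_two_pi_eq_one_iff.1 ?_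
    rw [mul_sub, mul_sub, Circle.exp_sub, Circle.exp_sub, hρ, hρ, hρ, mul_add, Circle.exp_add,
      map_mul]
    simp
  choose k hk using hk
  -- For fixed `s` the integer defect is continuous in `t`, hence constant, and its value at `t = 0`
  -- is `-ρ 0`. Thus `ρ - ρ 0` is additive and continuous, so linear.
  have hadd : ∀ s t, ρ (t + s) - ρ t - ρ s = -ρ 0 := by
    intro s t
    have hlc : IsLocallyConstant (k s) := isLocallyConstant_of_continuous_cast (by
      simp only [← hk]
      fun_prop)
    have : k s t = k s 0 := hlc.apply_eq_of_preconnectedSpace _ _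
    rw [hk, this, ← hk, zero_add]
    ring
  let f : ℝ →+ ℝ :=
    { toFun := fun t => ρ t - ρ 0
      map_zero' := sub_self _
      map_add' := fun t s => by linarith [hadd s t] }
  have hf : ∀ t, ρ t - ρ 0 = t * f 1 := by
    intro t
    have := map_real_smul f (show Continuous fun t => ρ t - ρ 0 by fun_prop) t 1
    rw [smul_eq_mul, mul_one, smul_eq_mul] at this
    exact this
  have hθc : ∀ t, θ (Circle.exp (2 * Real.pi * t)) = Circle.exp (2 * Real.pi * (t * f 1)) := by
    intro t
    rw [← hf, mul_sub, Circle.exp_sub, hρ, hρ]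
    simp
  have hc : f 1 * f 1 = 1 := by
    by_contra hne
    have hD : f 1 * f 1 - 1 ≠ 0 := sub_ne_zero.2 hne
    -- With slope `c = f 1`, involutivity makes `(c² - 1) t` an integer for every `t`; this `t`
    -- would give `1 / 2`.
    have h1 := hinv (Circle.exp (2 * Real.pi * (1 / (2 * (f 1 * f 1 - 1)))))
    rw [hθc, hθc, exp_two_pi_eq_iff] at h1
    obtain ⟨m, hm⟩ := h1
    have h2 : (1 : ℝ) / (2 * (f 1 * f 1 - 1)) * f 1 * f 1 - 1 / (2 * (f 1 * f 1 - 1)) = 1 / 2 := by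
      field_simp
      rw [sq, div_self hD]
    rw [h2] at hm
    have h3 : (1 : ℝ) = ((2 * m : ℤ) : ℝ) := by push_cast; linarith
    have h4 : (1 : ℤ) = 2 * m := by exact_mod_cast h3
    omega
  rcases mul_self_eq_one_iff.1 hc with h1 | h1
  · refine Or.inl fun z => ?_
    obtain ⟨t, rfl⟩ := hexp z
    rw [hθc, h1, mul_one]
  · refine Or.inr fun z => ?_
    obtain ⟨t, rfl⟩ := hexp z
    rw [hθc, h1, ← Circle.exp_neg]
    congr 1
    ring

/-! ### Central extensions by `U(1)` and the character `χ` -/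

namespace CircleExtension

variable {G : Type*} [Group G] [DiffeologicalSpace G] {σ : ℤˣ →* MulAut G}
  {Ghat : Type*} [Group Ghat] [DiffeologicalSpace Ghat] (E : CircleExtension σ Ghat)

lemma quot_incl (z : Circle) : E.quot (E.incl z) = 1 := by
  have : E.incl z ∈ E.quot.ker := E.range_incl ▸ ⟨z, rfl⟩
  exact this

lemma exists_incl_eq {g : Ghat} (h : E.quot g = 1) : ∃ z, E.incl z = g := by
  have : g ∈ E.incl.range := E.range_incl ▸ h
  exact this

lemma incl_mul_comm (z : Circle) (g : Ghat) : E.incl z * g = g * E.incl z :=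
  (Subgroup.mem_center_iff.1 (E.central ⟨z, rfl⟩) g).symm

/-- The automorphism of `U(1)` induced by the lifted action. -/
lemma exists_circle_action (ε : ℤˣ) :
    ∃ θ : Circle →* Circle, ∀ z, E.act ε (E.incl z) = E.incl (θ z) := by
  have h : ∀ z, ∃ w, E.incl w = E.act ε (E.incl z) := fun z =>
    E.exists_incl_eq (by rw [E.quot_act, quot_incl, map_one])
  choose θ hθ using h
  refine ⟨{ toFun := θ, map_one' := E.incl_injective ?_, map_mul' := fun z w =>
    E.incl_injective ?_ }, fun z => (hθ z).symm⟩
  · simp [hθ]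
  · simp [hθ]

/-- The lifted action preserves the kernel `U(1)`. The automorphism given by `-1` is smooth there
because `U(1) → Ĝ` is an induction, and it is an involution, so it is the identity or the inversion:
the two cases in the definition of `character`. -/
lemma act_incl (ε : ℤˣ) (z : Circle) :
    E.act ε (E.incl z) = E.incl (z ^ ((E.character ε : ℤˣ) : ℤ)) := by
  by_cases h : ∀ ε z, E.act ε (E.incl z) = E.incl z
  · simp [character, if_pos h, h ε z]
  · rw [character, if_neg h]
    rcases Int.units_eq_one_or ε with rfl | rfl
    · simp
    · obtain ⟨θ, hθ⟩ := E.exists_circle_action (-1)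
      have hsm : DSmooth θ := fun n p hp => (E.incl_induction n _).2 (by
        have h1 := E.act_smooth (-1) n _ ((E.incl_induction n _).1 hp)
        have h2 : E.act (-1) ∘ E.incl ∘ p = E.incl ∘ θ ∘ p := funext fun x => hθ (p x)
        rwa [h2] at h1)
      have hinv : ∀ z, θ (θ z) = z := fun z => E.incl_injective (by
        rw [← hθ, ← hθ, ← MulAut.mul_apply, ← map_mul]
        simp)
      rcases circle_involution hsm hinv with h1 | h1
      · refine absurd (fun ε z => ?_) h
        rcases Int.units_eq_one_or ε with rfl | rfl
        · simp
        · rw [hθ, h1]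
      · rw [hθ, h1]
        simp

/-- A central extension by `U(1)` as a principal `U(1)`-bundle. -/
def toPrincipalBundle [DiffeologicalGroup Ghat] : PrincipalBundle Circle G where
  Total := Ghat
  action := MulAction.compHom Ghat E.incl
  proj := E.quot
  subduction := E.quot_subduction
  proj_smul z g := by
    change E.quot (E.incl z * g) = _
    rw [map_mul, quot_incl, one_mul]
  smooth_smul n p hp := IsPlot.mul' ((E.incl_induction n _).1 hp.1) hp.2
  free_transitive g g' h := by
    obtain ⟨z, hz⟩ := E.exists_incl_eq (g := g * g'⁻¹) (by rw [map_mul, map_inv, h, mul_inv_cancel])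
    refine ⟨z, ?_, fun w hw => E.incl_injective ?_⟩
    · change g = E.incl z * g'
      rw [hz, inv_mul_cancel_right]
    · have hw' : g = E.incl w * g' := hw
      rw [hz, hw', mul_inv_cancel_right]
  smooth_div n h z hz hhz := by
    have h1 : IsPlot fun x => E.incl (h x) * z x := hhz
    refine (E.incl_induction n h).2 ?_
    have h2 := IsPlot.mul' h1 (IsPlot.inv' hz)
    simpa [Function.comp_def] using h2

lemma exists_lift [DiffeologicalGroup Ghat] {n : ℕ} {g : Euc n → G} (hg : IsPlot g) :
    ∃ g' : Euc n → Ghat, IsPlot g' ∧ ∀ x, E.quot (g' x) = g x :=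
  E.toPrincipalBundle.exists_section hg

end CircleExtension

open Cochain

/-! ### Cochain complexes -/

namespace Cochain

variable {C : Type*} [Category C] (F : Cᵒᵖ ⥤ AddCommGrpCat)

lemma d2_d1 (c : C1 F) : d2 F (d1 F c) = 0 := by
  ext x y z w φ ψ χ
  simp [d1, d2]
  abel

lemma d3_d2 (c : C2 F) : d3 F (d2 F c) = 0 := by
  ext x y z w t φ ψ χ θ
  simp [d2, d3]
  abel

variable {F}

lemma mk_eq_mk_H1 {c c' : (d1 F).ker} :
    (QuotientAddGroup.mk c : H1 F) = QuotientAddGroup.mk c' ↔ ∃ e, d0 F e = -c.1 + c'.1 :=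
  QuotientAddGroup.eq

lemma mk_eq_mk_H2 {c c' : (d2 F).ker} :
    (QuotientAddGroup.mk c : H2 F) = QuotientAddGroup.mk c' ↔ ∃ e, d1 F e = -c.1 + c'.1 :=
  QuotientAddGroup.eq

lemma mk_eq_mk_H3 {c c' : (d3 F).ker} :
    (QuotientAddGroup.mk c : H3 F) = QuotientAddGroup.mk c' ↔ ∃ e, d2 F e = -c.1 + c'.1 :=
  QuotientAddGroup.eq

/-- The induced map on `H²`. -/
def CoeffMap.mapH2 {C D : Type*} [Category C] [Category D] {T : C ⥤ D}
    {F : Dᵒᵖ ⥤ AddCommGrpCat} {F' : Cᵒᵖ ⥤ AddCommGrpCat} (η : CoeffMap T F F') : H2 F →+ H2 F' :=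
  QuotientAddGroup.map _ _
    ((η.pull2.comp (d2 F).ker.subtype).codRestrict (d2 F').ker fun c => by
      have hc : d2 F c.1 = 0 := c.2
      simp [AddMonoidHom.mem_ker, d2_pull, hc, map_zero η.pull3])
    (by
      rintro ⟨_, _⟩ ⟨b, rfl⟩
      exact ⟨η.pull1 b, η.d1_pull b⟩)

end Cochain

/-! ### Sections of the local systems -/

namespace PrincipalBundle

variable {H : Type*} [Group H] [DiffeologicalSpace H] {X : Type*} [DiffeologicalSpace X]
  (P : PrincipalBundle H X)

lemma isPlot_div {n : ℕ} {y z : Euc n → P.Total} (hy : IsPlot y) (hz : IsPlot z)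
    (h : ∀ x, P.proj (y x) = P.proj (z x)) : IsPlot fun x => P.div (h x) := by
  refine P.smooth_div n _ z hz ?_
  have : (fun x => P.div (h x) • z x) = y := funext fun x => (P.eq_div_smul (h x)).symm
  rwa [this]

end PrincipalBundle

variable {G : Type*} [Group G] [DiffeologicalSpace G] {σ : ℤˣ →* MulAut G}
  {X : Type*} [DiffeologicalSpace X] {Y : Type*} [DiffeologicalSpace Y]

lemma isLocallyConstant_right {n : ℕ} {h : Euc n → HGroup σ} (hh : IsPlot h) :
    IsLocallyConstant fun x => (h x).right :=
  hh.2

lemma isPlot_left {n : ℕ} {h : Euc n → HGroup σ} (hh : IsPlot h) : IsPlot fun x => (h x).left :=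
  hh.1

section Sections

variable {P : PrincipalBundle (HGroup σ) X} {χ : ℤˣ →* ℤˣ} {M : Type*} [AddCommGroup M]
  [DiffeologicalSpace M] [DiffeologicalAddGroup M] {p q : EuclideanPlot X}

lemma sectionFun_dSmooth (m : (localSystem P χ M).obj (op p)) : DSmooth (sectionFun m) :=
  m.2.1

lemma sectionFun_smul (m : (localSystem P χ M).obj (op p)) (h : HGroup σ)
    (z : P.PullbackTotal p.map) :
    sectionFun m (h • z) = ((χ h.right : ℤˣ) : ℤ) • sectionFun m z :=
  m.2.2 h z

lemma sectionFun_injective {m m' : (localSystem P χ M).obj (op p)}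
    (h : ∀ z, sectionFun m z = sectionFun m' z) : m = m' :=
  Subtype.ext (funext h)

lemma sectionFun_add (m m' : (localSystem P χ M).obj (op p)) (z : P.PullbackTotal p.map) :
    sectionFun (m + m') z = sectionFun m z + sectionFun m' z := rfl

lemma sectionFun_neg (m : (localSystem P χ M).obj (op p)) (z : P.PullbackTotal p.map) :
    sectionFun (-m) z = -sectionFun m z := rfl

lemma sectionFun_sub (m m' : (localSystem P χ M).obj (op p)) (z : P.PullbackTotal p.map) :
    sectionFun (m - m') z = sectionFun m z - sectionFun m' z := by
  rw [sub_eq_add_neg, sectionFun_add, sectionFun_neg, ← sub_eq_add_neg]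

lemma sectionFun_zero (z : P.PullbackTotal p.map) :
    sectionFun (0 : (localSystem P χ M).obj (op p)) z = 0 := rfl

lemma isPlot_units_smul {n : ℕ} {ε : Euc n → ℤˣ} (hε : IsLocallyConstant ε) {f : Euc n → M}
    (hf : IsPlot f) : IsPlot fun x => ((ε x : ℤˣ) : ℤ) • f x := by
  refine isPlot_of_nhds fun x => ⟨fun y => ((ε x : ℤˣ) : ℤ) • f y, ?_, ?_⟩
  · rcases Int.units_eq_one_or (ε x) with h | h
    · simpa [h] using hf
    · simpa [h, Function.comp_def] using DiffeologicalAddGroup.smooth_neg n f hf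
  · filter_upwards [(IsLocallyConstant.iff_eventually_eq _).1 hε x] with y hy
    rw [hy]

/-! ### Coordinates of sections in a trivialization, transition functions and changes of
trivialization -/

namespace PlotSections

variable (s : PlotSections P)

lemma proj_eq (z : P.PullbackTotal p.map) : P.proj z.1.2 = P.proj (s.sec p z.1.1) :=
  z.2.trans (s.proj_sec p _).symm

lemma eq_smul_point (z : P.PullbackTotal p.map) : z = P.div (s.proj_eq z) • s.point p z.1.1 :=
  Subtype.ext (Prod.ext rfl (P.eq_div_smul (s.proj_eq z)))

/-- Every point of the pull-back is a translate of some `(x, s_p(x))`, so equivariance leaves no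
other freedom. Identities between cochains in the twisted circle system are checked at these points.
-/
lemma section_ext {m m' : (localSystem P χ M).obj (op p)}
    (h : ∀ x, sectionFun m (s.point p x) = sectionFun m' (s.point p x)) : m = m' :=
  sectionFun_injective fun z => by
    rw [s.eq_smul_point z, sectionFun_smul, sectionFun_smul, h]

lemma isPlot_point (p : EuclideanPlot X) : IsPlot (s.point p) :=
  ⟨contDiff_id.isPlot, s.isPlot p⟩

/-- Over a Euclidean plot, smooth functions extend uniquely to sections of the local system. -/
lemma exists_section_eq {f : Euc p.dim → M} (hf : IsPlot f) :
    ∃ m : (localSystem P χ M).obj (op p), ∀ x, sectionFun m (s.point p x) = f x := by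
  -- Equivariance forces the value `χ(ε) f(x)` at `(g, ε) • s_p(x)`.
  refine ⟨(⟨fun z => ((χ (P.div (s.proj_eq z)).right : ℤˣ) : ℤ) • f z.1.1, fun n r hr => ?_,
    fun h z => ?_⟩ : equivariantFun P χ M p), fun x => ?_⟩
  · have h1 : IsPlot fun u => (r u).1.1 := hr.1
    have h2 : IsPlot fun u => P.div (s.proj_eq (r u)) :=
      P.isPlot_div hr.2 (isPlot_reparam (s.isPlot p) h1.contDiff) _
    exact isPlot_units_smul ((isLocallyConstant_right h2).comp χ)
      (isPlot_reparam hf h1.contDiff)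
  · have h1 : P.div (s.proj_eq (h • z)) = h * P.div (s.proj_eq z) := P.div_eq _
      ((congrArg (h • ·) (P.eq_div_smul (s.proj_eq z))).trans (mul_smul _ _ _).symm)
    change ((χ (P.div (s.proj_eq (h • z))).right : ℤˣ) : ℤ) • f z.1.1 = _
    rw [h1, SemidirectProduct.mul_right, map_mul, Units.val_mul, mul_smul]
  · change ((χ (P.div (s.proj_eq (s.point p x))).right : ℤˣ) : ℤ) • f x = _
    rw [P.div_eq (s.proj_eq (s.point p x)) (k := 1) (one_smul _ _).symm]
    simp

lemma sec_eq (φ : p ⟶ q) (x : Euc p.dim) :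
    s.sec p x = s.transition φ x • s.sec q (φ.toFun x) :=
  P.eq_div_smul _

lemma transition_eq {φ : p ⟶ q} {x : Euc p.dim} {h : HGroup σ}
    (hh : s.sec p x = h • s.sec q (φ.toFun x)) : s.transition φ x = h :=
  P.div_eq _ hh

lemma isPlot_transition (φ : p ⟶ q) : IsPlot (s.transition φ) :=
  P.isPlot_div (s.isPlot p) (isPlot_reparam (s.isPlot q) φ.smooth) _

lemma transition_comp {r : EuclideanPlot X} (φ : p ⟶ q) (ψ : q ⟶ r) (x : Euc p.dim) :
    s.transition (φ ≫ ψ) x = s.transition φ x * s.transition ψ (φ.toFun x) :=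
  s.transition_eq (by rw [mul_smul, s.sec_eq φ, s.sec_eq ψ]; rfl)

/-- Restriction along `φ` evaluates at `s_p = h_φ • (s_q ∘ φ)`, and equivariance extracts `χ(ε_φ)`.
This is the sign in the first term of the Čech differential. -/
lemma sectionFun_map_point (φ : p ⟶ q) (m : (localSystem P χ M).obj (op q)) (x : Euc p.dim) :
    sectionFun ((localSystem P χ M).map φ.op m) (s.point p x) =
      ((χ (s.transition φ x).right : ℤˣ) : ℤ) • sectionFun m (s.point q (φ.toFun x)) := by
  rw [← sectionFun_smul]
  exact congrArg (sectionFun m) (Subtype.ext (Prod.ext rfl (s.sec_eq φ x)))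

/-- The change of trivialization: `s_p = k_p • t_p`. -/
def change (s t : PlotSections P) (p : EuclideanPlot X) (x : Euc p.dim) : HGroup σ :=
  P.div (y := s.sec p x) (z := t.sec p x) ((s.proj_sec p x).trans (t.proj_sec p x).symm)

variable (t : PlotSections P)

lemma isPlot_change (p : EuclideanPlot X) : IsPlot (s.change t p) :=
  P.isPlot_div (s.isPlot p) (t.isPlot p) _

lemma point_eq_change_smul (p : EuclideanPlot X) (x : Euc p.dim) :
    s.point p x = s.change t p x • t.point p x :=
  Subtype.ext (Prod.ext rfl (P.eq_div_smul _))

/-- Both sides carry `t_q(φ(x))` to `s_p(x)`, one through `s_q` and the other through `t_p`; the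
action is free. -/
lemma transition_mul_change (φ : p ⟶ q) (x : Euc p.dim) :
    s.transition φ x * s.change t q (φ.toFun x) = s.change t p x * t.transition φ x := by
  refine P.smul_left_cancel' (z := t.sec q (φ.toFun x)) ?_
  rw [mul_smul, mul_smul, ← t.sec_eq, change, ← P.eq_div_smul, change, ← P.eq_div_smul, ← s.sec_eq]

end PlotSections

end Sections

lemma exists_plotSections (P : PrincipalBundle (HGroup σ) X) : Nonempty (PlotSections P) := by
  choose s hs hps using fun p : EuclideanPlot X => P.exists_section p.isPlot
  exact ⟨⟨s, hs, hps⟩⟩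

/-! ### The class `α` -/

/-- A locally constant `ε_φ` on the connected space `ℝⁿ` equals its value at `0`. The cocycle
condition is the `ℤ₂`-component of the composition law for transition functions. -/
lemma exists_isAlpha (P : PrincipalBundle (HGroup σ) X) : ∃ a, IsAlpha P a := by
  obtain ⟨s⟩ := exists_plotSections P
  refine ⟨_, s, ⟨fun p q φ => (Additive.ofMul (s.transition φ 0).right : Additive ℤˣ), ?_⟩,
    fun p q φ x => ?_, rfl⟩
  · refine (d1 (constZ2 X)).mem_ker.2 ?_
    funext p q r φ ψ
    have h0 : (s.transition ψ (φ.toFun 0)).right = (s.transition ψ 0).right :=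
      (isLocallyConstant_right (s.isPlot_transition ψ)).apply_eq_of_preconnectedSpace _ _
    have h := congrArg SemidirectProduct.right (s.transition_comp φ ψ 0)
    rw [SemidirectProduct.mul_right, h0] at h
    change (Additive.ofMul (s.transition ψ 0).right : Additive ℤˣ) -
      Additive.ofMul (s.transition (φ ≫ ψ) 0).right + Additive.ofMul (s.transition φ 0).right = 0
    rw [h, ofMul_mul]
    abel
  · exact (isLocallyConstant_right
      (s.isPlot_transition φ)).apply_eq_of_preconnectedSpace _ _

/-- The `ℤ₂`-component of the change of trivialization is the `0`-cochain whose coboundary is the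
difference of the two cocycles. -/
lemma IsAlpha.unique {P : PrincipalBundle (HGroup σ) X} {a b : H1 (constZ2 X)}
    (ha : IsAlpha P a) (hb : IsAlpha P b) : a = b := by
  obtain ⟨s, c, hc, rfl⟩ := ha
  obtain ⟨t, c', hc', rfl⟩ := hb
  refine mk_eq_mk_H1.2 ⟨fun p => (Additive.ofMul (s.change t p 0).right : Additive ℤˣ), ?_⟩
  funext p q φ
  have h0 : (s.change t q (φ.toFun 0)).right = (s.change t q 0).right :=
    (isLocallyConstant_right (s.isPlot_change t q)).apply_eq_of_preconnectedSpace _ _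
  have h := congrArg SemidirectProduct.right (s.transition_mul_change t φ 0)
  rw [SemidirectProduct.mul_right, SemidirectProduct.mul_right, h0, hc φ 0, hc' φ 0] at h
  have h' : (show Additive ℤˣ from c.1 φ) + Additive.ofMul (s.change t q 0).right =
    Additive.ofMul (s.change t p 0).right + (show Additive ℤˣ from c'.1 φ) := h
  change (Additive.ofMul (s.change t q 0).right : Additive ℤˣ) -
    Additive.ofMul (s.change t p 0).right =
      -(show Additive ℤˣ from c.1 φ) + (show Additive ℤˣ from c'.1 φ)
  rw [sub_eq_iff_eq_add, eq_comm, add_assoc, add_comm _ (Additive.ofMul _), ← h',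
    neg_add_cancel_left]

/-! ### The exponential sequence -/

section Exponential

variable (P : PrincipalBundle (HGroup σ) X) (χ : ℤˣ →* ℤˣ)

/-- A smooth homomorphism of groups of coefficients induces a map of local systems. -/
def localSystemMap {M N : Type*} [AddCommGroup M] [DiffeologicalSpace M] [DiffeologicalAddGroup M]
    [AddCommGroup N] [DiffeologicalSpace N] [DiffeologicalAddGroup N] (θ : M →+ N)
    (hθ : DSmooth θ) :
    CoeffMap (𝟭 (EuclideanPlot X)) (localSystem P χ M) (localSystem P χ N) where
  app p :=
    { toFun := fun (m : equivariantFun P χ M _) => show equivariantFun P χ N p from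
        ⟨fun z => θ (m.1 z), hθ.comp m.2.1, fun h z =>
          (congrArg θ (m.2.2 h z)).trans (map_zsmul θ _ _)⟩
      map_zero' := Subtype.ext (funext fun _ => θ.map_zero)
      map_add' := fun _ _ => Subtype.ext (funext fun _ => θ.map_add _ _) }
  naturality _ _ := rfl

/-- The homomorphism `t ↦ exp (2π i t)` from `ℝ` to `U(1)`. -/
def realToCircle : ℝ →+ Additive Circle where
  toFun t := Additive.ofMul (Circle.exp (2 * Real.pi * t))
  map_zero' := by simp
  map_add' s t := by rw [mul_add, Circle.exp_add, ofMul_mul]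

lemma dSmooth_realToCircle : DSmooth realToCircle :=
  fun _ _ hp => isPlot_exp_two_pi hp.contDiff

lemma dSmooth_intCast : DSmooth (Int.castAddHom ℝ) := fun n p hp => by
  have hp' : IsLocallyConstant p := hp
  refine isPlot_of_nhds fun x => ⟨fun _ => (p x : ℝ), isPlot_const, ?_⟩
  filter_upwards [(IsLocallyConstant.iff_eventually_eq _).1 hp' x] with y hy
  simp [hy]

/-- The map `ℝ_α → U(1)_α`. -/
abbrev expMap := localSystemMap P χ realToCircle dSmooth_realToCircle

/-- The map `ℤ_α → ℝ_α`. -/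
abbrev castMap := localSystemMap P χ (Int.castAddHom ℝ) dSmooth_intCast

variable {P χ} {p : EuclideanPlot X}

lemma sectionFun_expMap (r : (localSystem P χ ℝ).obj (op p)) (z : P.PullbackTotal p.map) :
    sectionFun ((expMap P χ).app p r) z = realToCircle (sectionFun r z) := rfl

/-- In a trivialization a section is a circle-valued function on `ℝⁿ`; it has a smooth logarithm,
which extends equivariantly. -/
lemma expMap_surjective (m : (localSystem P χ (Additive Circle)).obj (op p)) :
    ∃ r, (expMap P χ).app p r = m := by
  obtain ⟨s⟩ := exists_plotSections P
  have h : IsPlot fun x => (sectionFun m (s.point p x)).toMul :=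
    sectionFun_dSmooth m _ _ (s.isPlot_point p)
  obtain ⟨r, hr, hrm⟩ := exists_circle_lift h
  obtain ⟨r', hr'⟩ := s.exists_section_eq (χ := χ) hr.isPlot
  refine ⟨r', s.section_ext fun x => ?_⟩
  rw [sectionFun_expMap, hr']
  exact hrm x

lemma castMap_injective : Function.Injective ((castMap P χ).app p) := fun m m' h =>
  sectionFun_injective fun z => by
    have : ((sectionFun m z : ℤ) : ℝ) = (sectionFun m' z : ℤ) :=
      congrArg (fun m => sectionFun (P := P) (χ := χ) (M := ℝ) m z) h
    exact_mod_cast this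

/-- A smooth function with integer values is locally constant along plots, hence smooth into
discrete `ℤ`, and equivariance can be tested in `ℝ`. -/
lemma exists_castMap_eq {r : (localSystem P χ ℝ).obj (op p)} (h : (expMap P χ).app p r = 0) :
    ∃ m, (castMap P χ).app p m = r := by
  have hk : ∀ z, ∃ k : ℤ, sectionFun r z = k := fun z => by
    have h1 : sectionFun ((expMap P χ).app p r) z = 0 := by rw [h, sectionFun_zero]
    exact exp_two_pi_eq_one_iff.1 h1
  choose k hk using hk
  refine ⟨(⟨k, fun n q hq => ?_, fun h z => ?_⟩ : equivariantFun P χ ℤ p),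
    sectionFun_injective fun z => (hk z).symm⟩
  · have h1 : IsPlot (sectionFun r ∘ q) := sectionFun_dSmooth r n q hq
    have h2 : IsLocallyConstant (k ∘ q) := isLocallyConstant_of_continuous_cast (by
      have := h1.contDiff.continuous
      simpa only [Function.comp_def, hk] using this)
    exact h2
  · have h1 := sectionFun_smul r h z
    rw [hk, hk] at h1
    have h2 : ((k (h • z) : ℤ) : ℝ) = (((χ h.right : ℤˣ) : ℤ) • k z : ℤ) := by
      rw [h1]; simp
    exact_mod_cast h2

variable {Ghat : Type*} [Group Ghat] [DiffeologicalSpace Ghat]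

/-- Turns the pointwise conditions into identities of cochains, so that the diagram chases use only
`d ∘ d = 0` and compatibility of coefficient maps with `d`. -/
lemma isConnecting_iff {E : CircleExtension σ Ghat} {b : H2 (circleSystem E P)}
    {d : H3 (intSystem E P)} :
    IsConnecting E P b d ↔ ∃ (a : (d2 (circleSystem E P)).ker) (r : C2 (realSystem E P))
      (n : (d3 (intSystem E P)).ker), (expMap P E.character).pull2 r = a.1 ∧
        d2 _ r = (castMap P E.character).pull3 n.1 ∧
        b = QuotientAddGroup.mk a ∧ d = QuotientAddGroup.mk n := by
  refine exists_congr fun a => exists_congr fun r => exists_congr fun n =>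
    and_congr ⟨fun h => ?_, fun h => ?_⟩ (and_congr ⟨fun h => ?_, fun h => ?_⟩ Iff.rfl)
  · funext p q s φ ψ
    exact sectionFun_injective fun z => h φ ψ z
  · intro p q s φ ψ z
    rw [← h]
    rfl
  · funext p q s t φ ψ θ
    exact sectionFun_injective fun z => h φ ψ θ z
  · intro p q s t φ ψ θ z
    rw [h]
    rfl

/-- Termwise logarithms `r` of `a` have `exp (d r) = d a = 0`, so `d r` comes from an integer
cochain `n`; `d n = 0` since `ℤ → ℝ` is injective and `d (d r) = 0`. -/
lemma exists_isConnecting (E : CircleExtension σ Ghat) (b : H2 (circleSystem E P)) :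
    ∃ d, IsConnecting E P b d := by
  induction b using QuotientAddGroup.induction_on with
  | H a =>
  let exp := expMap P E.character
  let cast := castMap P E.character
  choose log hlog using fun p : EuclideanPlot X =>
    expMap_surjective (P := P) (χ := E.character) (p := p)
  let r : C2 (realSystem E P) := fun p _ _ φ ψ => log p (a.1 φ ψ)
  have hr : exp.pull2 r = a.1 := by
    funext p q s φ ψ
    exact hlog p _
  have hdr : exp.pull3 (d2 _ r) = 0 := by
    have ha : d2 _ a.1 = 0 := a.2
    rw [← exp.d2_pull, hr, ha]
  have hn : ∃ n : C3 (intSystem E P), cast.pull3 n = d2 _ r := by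
    have h : ∀ ⦃p q s t : EuclideanPlot X⦄ (φ : p ⟶ q) (ψ : q ⟶ s) (θ : s ⟶ t),
        ∃ m, (castMap P E.character).app p m = d2 (realSystem E P) r φ ψ θ :=
      fun p q s t φ ψ θ => exists_castMap_eq
        (congrFun (congrFun (congrFun (congrFun (congrFun (congrFun (congrFun hdr p)
          q) s) t) φ) ψ) θ)
    choose n hn using h
    exact ⟨n, by funext p q s t φ ψ θ; exact hn φ ψ θ⟩
  obtain ⟨n, hn⟩ := hn
  have hdn : d3 _ n = 0 := by
    have h : cast.pull4 (d3 _ n) = 0 := by rw [← cast.d3_pull, hn, d3_d2]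
    funext p q s t u φ ψ θ κ
    refine castMap_injective (Eq.trans
      (congrFun (congrFun (congrFun (congrFun (congrFun (congrFun (congrFun (congrFun (congrFun
        h p) q) s) t) u) φ) ψ) θ) κ) (map_zero _).symm)
  exact ⟨_, isConnecting_iff.2 ⟨a, r, ⟨n, hdn⟩, hr, hn.symm, rfl, rfl⟩⟩

/-- If `a' - a = d e` and `e'` is a logarithm of `e`, then `r' - r - d e'` is killed by `exp`, hence
is an integer cochain `m`, and `d m = n' - n`. This treats the choices of representative and of
logarithm together. -/
lemma IsConnecting.unique {E : CircleExtension σ Ghat} {b : H2 (circleSystem E P)}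
    {d d' : H3 (intSystem E P)} (hd : IsConnecting E P b d) (hd' : IsConnecting E P b d') :
    d = d' := by
  obtain ⟨a, r, n, h1, h2, rfl, rfl⟩ := isConnecting_iff.1 hd
  obtain ⟨a', r', n', h1', h2', hb, rfl⟩ := isConnecting_iff.1 hd'
  obtain ⟨e, he⟩ := mk_eq_mk_H2.1 hb
  let exp := expMap P E.character
  let cast := castMap P E.character
  choose log hlog using fun p : EuclideanPlot X =>
    expMap_surjective (P := P) (χ := E.character) (p := p)
  let e' : C1 (realSystem E P) := fun p _ φ => log p (e φ)
  have he' : exp.pull1 e' = e := by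
    funext p q φ
    exact hlog p _
  have hexp : exp.pull2 (-r + r' - d1 _ e') = 0 := by
    rw [map_sub, map_add, map_neg, ← exp.d1_pull, he']
    rw [h1, h1', he, sub_self]
  have hm : ∃ m : C2 (intSystem E P), cast.pull2 m = -r + r' - d1 _ e' := by
    have h : ∀ ⦃p q s : EuclideanPlot X⦄ (φ : p ⟶ q) (ψ : q ⟶ s),
        ∃ m, (castMap P E.character).app p m = (-r + r' - d1 (realSystem E P) e') φ ψ :=
      fun p q s φ ψ => exists_castMap_eq
        (congrFun (congrFun (congrFun (congrFun (congrFun hexp p) q) s) φ) ψ)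
    choose m hm using h
    exact ⟨m, by funext p q s φ ψ; exact hm φ ψ⟩
  obtain ⟨m, hm⟩ := hm
  refine mk_eq_mk_H3.2 ⟨m, ?_⟩
  have h : cast.pull3 (d2 _ m) = cast.pull3 (-n.1 + n'.1) := by
    rw [← cast.d2_pull, hm, map_sub, map_add, map_neg, d2_d1, sub_zero, h2, h2', map_add, map_neg]
  funext p q s t φ ψ θ
  exact castMap_injective
    (congrFun (congrFun (congrFun (congrFun (congrFun (congrFun (congrFun h p) q) s) t) φ) ψ) θ)

end Exponential

/-! ### The class `β` -/

section Beta

variable {G : Type*} [Group G] [DiffeologicalSpace G] {σ : ℤˣ →* MulAut G}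
  {X : Type*} [DiffeologicalSpace X] {Ghat : Type*} [Group Ghat] [DiffeologicalSpace Ghat]

/-! ### The extension `Ĝ ⋊ ℤ₂` of `H_σ` by `U(1)` -/

namespace CircleExtension

variable (E : CircleExtension σ Ghat)

/-- The projection `Ĝ ⋊ ℤ₂ → G ⋊ ℤ₂`. -/
def quotHat : (Ghat ⋊[E.act] ℤˣ) →* HGroup σ :=
  SemidirectProduct.map E.quot (MonoidHom.id _) fun ε => MonoidHom.ext fun g => E.quot_act ε g

/-- The inclusion `U(1) → Ĝ ⋊ ℤ₂`. -/
def inclHat : Circle →* Ghat ⋊[E.act] ℤˣ :=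
  SemidirectProduct.inl.comp E.incl

lemma quotHat_eq_iff {k : Ghat ⋊[E.act] ℤˣ} {h : HGroup σ} :
    E.quotHat k = h ↔ E.quot k.left = h.left ∧ k.right = h.right :=
  SemidirectProduct.ext_iff

lemma inclHat_injective : Function.Injective E.inclHat :=
  SemidirectProduct.inl_injective.comp E.incl_injective

/-- `U(1)` is central in `Ĝ` but in general only normal in `Ĝ ⋊ ℤ₂`, where the `ℤ₂`-component acts
on it through `χ`. -/
lemma mul_inclHat (k : Ghat ⋊[E.act] ℤˣ) (z : Circle) :
    k * E.inclHat z = E.inclHat (z ^ ((E.character k.right : ℤˣ) : ℤ)) * k := by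
  have h : E.inclHat (z ^ ((E.character k.right : ℤˣ) : ℤ)) =
      SemidirectProduct.inl (E.incl (z ^ ((E.character k.right : ℤˣ) : ℤ))) := rfl
  rw [h]
  refine SemidirectProduct.ext ?_ ?_
  · rw [SemidirectProduct.mul_left, SemidirectProduct.mul_left, SemidirectProduct.left_inl,
      SemidirectProduct.right_inl, map_one, MulAut.one_apply, incl_mul_comm, ← E.act_incl]
    rfl
  · rw [SemidirectProduct.mul_right, SemidirectProduct.mul_right, SemidirectProduct.right_inl,
      one_mul]
    exact mul_one _

lemma exists_eq_inclHat_mul {k l : Ghat ⋊[E.act] ℤˣ} (h : E.quotHat k = E.quotHat l) :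
    ∃ z, k = E.inclHat z * l := by
  obtain ⟨hl, hr⟩ := SemidirectProduct.ext_iff.1 h
  have hl' : E.quot k.left = E.quot l.left := hl
  have hr' : k.right = l.right := hr
  obtain ⟨z, hz⟩ := E.exists_incl_eq (g := k.left * l.left⁻¹)
    (by rw [map_mul, map_inv, hl', mul_inv_cancel])
  exact ⟨z, SemidirectProduct.ext (by simp [inclHat, hz]) (by simp [inclHat, hr'])⟩

variable {E} {n : ℕ}

lemma isPlot_act {ε : Euc n → ℤˣ} (hε : IsLocallyConstant ε) {g : Euc n → Ghat} (hg : IsPlot g) :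
    IsPlot fun x => E.act (ε x) (g x) := by
  refine isPlot_of_nhds fun x => ⟨_, E.act_smooth (ε x) n g hg, ?_⟩
  filter_upwards [(IsLocallyConstant.iff_eventually_eq _).1 hε x] with y hy
  rw [hy]
  rfl

/-- A map to `Ĝ ⋊ ℤ₂` is smooth if its components are. -/
def IsPlotHat (k : Euc n → Ghat ⋊[E.act] ℤˣ) : Prop :=
  IsPlot (fun x => (k x).left) ∧ IsLocallyConstant fun x => (k x).right

lemma IsPlotHat.comp {m : ℕ} {k : Euc n → Ghat ⋊[E.act] ℤˣ} (hk : IsPlotHat k)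
    {f : Euc m → Euc n} (hf : ContDiff ℝ ∞ f) : IsPlotHat fun x => k (f x) :=
  ⟨isPlot_reparam hk.1 hf, hk.2.comp_continuous hf.continuous⟩

variable [DiffeologicalGroup Ghat]

lemma IsPlotHat.mul {k l : Euc n → Ghat ⋊[E.act] ℤˣ} (hk : IsPlotHat k) (hl : IsPlotHat l) :
    IsPlotHat fun x => k x * l x :=
  ⟨IsPlot.mul' hk.1 (isPlot_act hk.2 hl.1), hk.2.mul hl.2⟩

/-- Two smooth lifts of a map to `G ⋊ ℤ₂` differ by a smooth circle-valued function. -/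
lemma IsPlotHat.exists_eq_inclHat_mul {k l : Euc n → Ghat ⋊[E.act] ℤˣ} (hk : IsPlotHat k)
    (hl : IsPlotHat l) (h : ∀ x, E.quotHat (k x) = E.quotHat (l x)) :
    ∃ z : Euc n → Circle, IsPlot z ∧ ∀ x, k x = E.inclHat (z x) * l x := by
  choose z hz using fun x => E.exists_eq_inclHat_mul (h x)
  refine ⟨z, (E.incl_induction n z).2 ?_, hz⟩
  have h1 : E.incl ∘ z = fun x => (k x).left * (l x).left⁻¹ := by
    funext x
    simp [hz x, inclHat]
  rw [h1]
  exact IsPlot.mul' hk.1 (IsPlot.inv' hl.1)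

lemma exists_isPlotHat_lift (E : CircleExtension σ Ghat) {h : Euc n → HGroup σ} (hh : IsPlot h) :
    ∃ k : Euc n → Ghat ⋊[E.act] ℤˣ, IsPlotHat k ∧ ∀ x, E.quotHat (k x) = h x := by
  obtain ⟨g, hg, hgh⟩ := E.exists_lift (isPlot_left hh)
  have hr := isLocallyConstant_right hh
  exact ⟨fun x => ⟨g x, (h x).right⟩, ⟨hg, hr⟩,
    fun x => E.quotHat_eq_iff.2 ⟨hgh x, rfl⟩⟩

end CircleExtension

open CircleExtension

variable {E : CircleExtension σ Ghat} {P : PrincipalBundle (HGroup σ) X}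

namespace LiftingData

variable (L : LiftingData E P) {p q r : EuclideanPlot X}

/-- The lift `(ĝ_φ, ε_φ)` of the transition function to `Ĝ ⋊ ℤ₂`. -/
def hat (φ : p ⟶ q) (x : Euc p.dim) : Ghat ⋊[E.act] ℤˣ :=
  ⟨L.lift φ x, (L.transition φ x).right⟩

lemma quotHat_hat (φ : p ⟶ q) (x : Euc p.dim) : E.quotHat (L.hat φ x) = L.transition φ x :=
  E.quotHat_eq_iff.2 ⟨L.quot_lift φ x, rfl⟩

lemma isPlotHat_hat (φ : p ⟶ q) : IsPlotHat (L.hat φ) :=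
  have h := isLocallyConstant_right (L.isPlot_transition φ)
  ⟨L.isPlot_lift φ, h⟩

lemma quotHat_hat_mul (φ : p ⟶ q) (ψ : q ⟶ r) (x : Euc p.dim) :
    E.quotHat (L.hat φ x * L.hat ψ (φ.toFun x)) = E.quotHat (L.hat (φ ≫ ψ) x) := by
  rw [map_mul, quotHat_hat, quotHat_hat, quotHat_hat, L.transition_comp]

/-- The `ℤ₂`-components on the right agree automatically, so only the `Ĝ`-component carries
information. Thus `a` measures the failure of `(ĝ_φ, ε_φ)` to be multiplicative. -/
lemma incl_eq_iff (φ : p ⟶ q) (ψ : q ⟶ r) (x : Euc p.dim) (z : Circle) :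
    E.incl z = L.lift φ x * E.act (L.transition φ x).right (L.lift ψ (φ.toFun x)) *
        (L.lift (φ ≫ ψ) x)⁻¹ ↔
      L.hat φ x * L.hat ψ (φ.toFun x) = E.inclHat z * L.hat (φ ≫ ψ) x := by
  rw [eq_mul_inv_iff_mul_eq, SemidirectProduct.ext_iff, eq_comm, hat, hat, hat]
  simp [inclHat, L.transition_comp]

end LiftingData

/-- The cochain `a` has the coordinates `a_{φ,ψ}` in the trivialization and the lifts of `L`. -/
def IsBetaCochain (L : LiftingData E P) (a : C2 (circleSystem E P)) : Prop :=
  ∀ ⦃p q r : EuclideanPlot X⦄ (φ : p ⟶ q) (ψ : q ⟶ r) (x : Euc p.dim),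
    L.hat φ x * L.hat ψ (φ.toFun x) =
      E.inclHat (sectionFun (a φ ψ) (L.point p x)).toMul * L.hat (φ ≫ ψ) x

lemma isBeta_iff {b : H2 (circleSystem E P)} :
    IsBeta E P b ↔ ∃ (L : LiftingData E P) (a : (d2 (circleSystem E P)).ker),
      IsBetaCochain L a.1 ∧ b = QuotientAddGroup.mk a := by
  refine exists_congr fun L => exists_congr fun a => and_congr ?_ Iff.rfl
  exact forall_congr' fun p => forall_congr' fun q => forall_congr' fun r => forall_congr' fun φ =>
    forall_congr' fun ψ => forall_congr' fun x => L.incl_eq_iff φ ψ x _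

/-- The product of the lifts of `φ`, `ψ`, `θ` is expanded with both bracketings. Moving `a_{ψ,θ}` to
the left past the lift of `φ` produces the sign `χ(ε_φ)` required by `d2`. -/
lemma IsBetaCochain.d2_eq_zero {L : LiftingData E P} {a : C2 (circleSystem E P)}
    (ha : IsBetaCochain L a) : d2 _ a = 0 := by
  funext p q r s φ ψ θ
  refine L.section_ext fun x => ?_
  change sectionFun ((circleSystem E P).map φ.op (a ψ θ) - a (φ ≫ ψ) θ + a φ (ψ ≫ θ) - a φ ψ) _ = 0
  rw [sectionFun_sub, sectionFun_add, sectionFun_sub, L.sectionFun_map_point]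
  have h1 := ha ψ θ (φ.toFun x)
  have h2 := ha φ (ψ ≫ θ) x
  have h3 := ha φ ψ x
  have h4 := ha (φ ≫ ψ) θ x
  generalize sectionFun (a ψ θ) (L.point q (φ.toFun x)) = w1 at *
  generalize sectionFun (a φ (ψ ≫ θ)) (L.point p x) = w2 at *
  generalize sectionFun (a φ ψ) (L.point p x) = w3 at *
  generalize sectionFun (a (φ ≫ ψ) θ) (L.point p x) = w4 at *
  have h5 : E.inclHat (w1.toMul ^ ((E.character (L.transition φ x).right : ℤˣ) : ℤ) * w2.toMul) =
      E.inclHat (w3.toMul * w4.toMul) := by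
    refine mul_right_cancel (b := L.hat (φ ≫ ψ ≫ θ) x) ?_
    have h6 : L.hat φ x * (L.hat ψ (φ.toFun x) * L.hat θ (ψ.toFun (φ.toFun x))) =
        (L.hat φ x * L.hat ψ (φ.toFun x)) * L.hat θ (ψ.toFun (φ.toFun x)) :=
      (mul_assoc _ _ _).symm
    rw [h1, h3, ← mul_assoc, E.mul_inclHat, mul_assoc, h2, mul_assoc] at h6
    have h7 : L.hat (φ ≫ ψ) x * L.hat θ (ψ.toFun (φ.toFun x)) = _ := h4
    rw [h7] at h6
    rw [map_mul, map_mul, mul_assoc, mul_assoc]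
    exact h6
  have h6 := congrArg Additive.ofMul (E.inclHat_injective h5)
  have h7 : ((E.character (L.transition φ x).right : ℤˣ) : ℤ) • w1 + w2 = w3 + w4 := h6
  rw [sub_add_eq_add_sub, h7]
  abel

variable [DiffeologicalGroup Ghat]

/-- The two lifts of the transition function of `φ ≫ ψ` differ by a smooth circle-valued function,
which extends to a section of the local system. -/
lemma exists_isBeta (E : CircleExtension σ Ghat) (P : PrincipalBundle (HGroup σ) X) :
    ∃ b, IsBeta E P b := by
  obtain ⟨s⟩ := exists_plotSections P
  choose g hg hgs using fun (p q : EuclideanPlot X) (φ : p ⟶ q) =>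
    E.exists_lift (isPlot_left (s.isPlot_transition φ))
  let L : LiftingData E P := { s with lift := g, isPlot_lift := hg, quot_lift := hgs }
  have h : ∀ ⦃p q r : EuclideanPlot X⦄ (φ : p ⟶ q) (ψ : q ⟶ r),
      ∃ m : (circleSystem E P).obj (op p), ∀ x : Euc p.dim,
        L.hat φ x * L.hat ψ (φ.toFun x) =
          E.inclHat (sectionFun m (L.point p x)).toMul * L.hat (φ ≫ ψ) x := by
    intro p q r φ ψ
    obtain ⟨z, hz, hzL⟩ := ((L.isPlotHat_hat φ).mul ((L.isPlotHat_hat ψ).comp φ.smooth)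
      ).exists_eq_inclHat_mul (L.isPlotHat_hat (φ ≫ ψ)) (L.quotHat_hat_mul φ ψ)
    obtain ⟨m, hm⟩ := L.exists_section_eq (P := P) (χ := E.character) (M := Additive Circle)
      (f := fun x => Additive.ofMul (z x)) hz
    exact ⟨m, fun x => by rw [hm]; exact hzL x⟩
  choose a ha using h
  have ha' : IsBetaCochain L a := ha
  exact ⟨_, isBeta_iff.2 ⟨L, ⟨a, ha'.d2_eq_zero⟩, ha', rfl⟩⟩

/-- Lift the change of trivialization to `k_p` in `Ĝ ⋊ ℤ₂`. The products of the new lift of `φ` with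
`k_q`, and of `k_p` with the old lift, have the same image in `H_σ`, so they differ by some `e_φ` in
`U(1)`, and `d e = a' - a`. -/
lemma IsBeta.unique {b b' : H2 (circleSystem E P)} (hb : IsBeta E P b) (hb' : IsBeta E P b') :
    b = b' := by
  obtain ⟨L, a, ha, rfl⟩ := isBeta_iff.1 hb
  obtain ⟨L', a', ha', rfl⟩ := isBeta_iff.1 hb'
  choose k hk hkc using fun p : EuclideanPlot X =>
    E.exists_isPlotHat_lift (L'.isPlot_change L.toPlotSections p)
  have h : ∀ ⦃p q : EuclideanPlot X⦄ (φ : p ⟶ q), ∃ m : (circleSystem E P).obj (op p),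
      ∀ x : Euc p.dim, L'.hat φ x * k q (φ.toFun x) =
        E.inclHat (sectionFun m (L'.point p x)).toMul * (k p x * L.hat φ x) := by
    intro p q φ
    obtain ⟨z, hz, hzL⟩ := ((L'.isPlotHat_hat φ).mul ((hk q).comp φ.smooth)).exists_eq_inclHat_mul
      ((hk p).mul (L.isPlotHat_hat φ)) fun x => by
        rw [map_mul, map_mul, L.quotHat_hat, L'.quotHat_hat, hkc, hkc,
          L'.transition_mul_change L.toPlotSections]
    obtain ⟨m, hm⟩ := L'.exists_section_eq (P := P) (χ := E.character) (M := Additive Circle)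
      (f := fun x => Additive.ofMul (z x)) hz
    exact ⟨m, fun x => by rw [hm]; exact hzL x⟩
  choose e he using h
  refine mk_eq_mk_H2.2 ⟨e, ?_⟩
  funext p q r φ ψ
  refine L'.section_ext fun x => ?_
  change sectionFun ((circleSystem E P).map φ.op (e ψ) - e (φ ≫ ψ) + e φ) _ =
    sectionFun (-a.1 φ ψ + a'.1 φ ψ) _
  rw [sectionFun_add, sectionFun_sub, sectionFun_add, sectionFun_neg, L'.sectionFun_map_point]
  -- The old cocycle is given at the points of `L` but compared at those of `L'`; the resulting sign
  -- is the one picked up when its value crosses `k_p` below.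
  have hpt : sectionFun (a.1 φ ψ) (L'.point p x) =
      ((E.character (k p x).right : ℤˣ) : ℤ) • sectionFun (a.1 φ ψ) (L.point p x) := by
    rw [L'.point_eq_change_smul L.toPlotSections, sectionFun_smul,
      (E.quotHat_eq_iff.1 (hkc p x)).2]
  rw [hpt]
  have h1 := he φ x
  have h2 := he ψ (φ.toFun x)
  have h3 : L'.hat (φ ≫ ψ) x * k r (ψ.toFun (φ.toFun x)) = _ := he (φ ≫ ψ) x
  have h4 := ha φ ψ x
  have h5 := ha' φ ψ x
  generalize sectionFun (e φ) (L'.point p x) = w1 at *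
  generalize sectionFun (e ψ) (L'.point q (φ.toFun x)) = w2 at *
  generalize sectionFun (e (φ ≫ ψ)) (L'.point p x) = w3 at *
  generalize sectionFun (a.1 φ ψ) (L.point p x) = w4 at *
  generalize sectionFun (a'.1 φ ψ) (L'.point p x) = w5 at *
  -- Two evaluations of the new lift of `φ` times the new lift of `ψ` times `k_r`: through `a'` and
  -- `e` at `φ ≫ ψ`, or through `e_ψ`, `e_φ` and `a`.
  have h6 : E.inclHat (w5.toMul * w3.toMul) =
      E.inclHat (w2.toMul ^ ((E.character (L'.transition φ x).right : ℤˣ) : ℤ) *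
        (w1.toMul * w4.toMul ^ ((E.character (k p x).right : ℤˣ) : ℤ))) := by
    refine mul_right_cancel (b := k p x * L.hat (φ ≫ ψ) x) ?_
    have h7 : L'.hat φ x * (L'.hat ψ (φ.toFun x) * k r (ψ.toFun (φ.toFun x))) =
        L'.hat φ x * L'.hat ψ (φ.toFun x) * k r (ψ.toFun (φ.toFun x)) := (mul_assoc _ _ _).symm
    rw [h2, h5, mul_assoc _ (L'.hat (φ ≫ ψ) x), h3, ← mul_assoc, E.mul_inclHat, mul_assoc,
      ← mul_assoc (L'.hat φ x), h1, mul_assoc _ (k p x * L.hat φ x), mul_assoc (k p x), h4,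
      ← mul_assoc (k p x), E.mul_inclHat] at h7
    simp only [map_mul, mul_assoc] at h7 ⊢
    exact h7.symm
  have h7 : w5 + w3 = ((E.character (L'.transition φ x).right : ℤˣ) : ℤ) • w2 +
      (w1 + ((E.character (k p x).right : ℤˣ) : ℤ) • w4) :=
    congrArg Additive.ofMul (E.inclHat_injective h6)
  rw [sub_add_eq_add_sub, sub_eq_iff_eq_add, add_assoc, h7]
  abel

/-- The twisting datum of a principal bundle is well defined. -/
theorem existsUnique_isTwistingDatum (E : CircleExtension σ Ghat)
    (P : PrincipalBundle (HGroup σ) X) : ∃! t, IsTwistingDatum E P t := by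
  obtain ⟨a, ha⟩ := exists_isAlpha P
  obtain ⟨b, hb⟩ := exists_isBeta E P
  obtain ⟨d, hd⟩ := exists_isConnecting E b
  refine ⟨(a, d), ⟨ha, b, hb, hd⟩, ?_⟩
  rintro ⟨a', d'⟩ ⟨ha', b', hb', hd'⟩
  obtain rfl := hb'.unique hb
  exact Prod.ext (ha'.unique ha) (IsConnecting.unique hd' hd)

lemma isTwistingDatum_twistingDatum (E : CircleExtension σ Ghat)
    (P : PrincipalBundle (HGroup σ) X) : IsTwistingDatum E P (twistingDatum E P) :=
  Classical.epsilon_spec (existsUnique_isTwistingDatum E P).exists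

end Beta

/-! ### Naturality -/

section Naturality

variable {G : Type*} [Group G] [DiffeologicalSpace G] {σ : ℤˣ →* MulAut G}
  {X : Type*} [DiffeologicalSpace X] {Y : Type*} [DiffeologicalSpace Y]
  {Ghat : Type*} [Group Ghat] [DiffeologicalSpace Ghat]
  {P : PrincipalBundle (HGroup σ) X} {Q : PrincipalBundle (HGroup σ) Y}
  {f : X → Y} {hf : DSmooth f} (Φ : P.Iso (Q.pullback f hf))

/-- The point `(p(x), s_{f ∘ p}(x))` of the pull-back of `Q` along `f`. -/
def PlotSections.pullbackPoint (hf : DSmooth f) (s : PlotSections Q) (p : EuclideanPlot X)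
    (x : Euc p.dim) : (Q.pullback f hf).Total :=
  (⟨(p.map x, s.sec ((EuclideanPlot.push f hf).obj p) x),
    s.proj_sec ((EuclideanPlot.push f hf).obj p) x⟩ : Q.PullbackTotal f)

lemma PlotSections.isPlot_pullbackPoint (s : PlotSections Q) (p : EuclideanPlot X) :
    IsPlot (s.pullbackPoint hf p) :=
  (show _ ∧ _ from ⟨p.isPlot, s.isPlot ((EuclideanPlot.push f hf).obj p)⟩)

/-- The trivialization of `P ≅ f^*Q` induced by a trivialization of `Q`. -/
def PlotSections.pull (s : PlotSections Q) : PlotSections P where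
  sec p x := Φ.toEquiv.symm (s.pullbackPoint hf p x)
  isPlot p := Φ.smooth_invFun _ _ (s.isPlot_pullbackPoint p)
  proj_sec p x := by
    rw [← Φ.proj_comp, Equiv.apply_symm_apply]
    rfl

/-- Equivariance of `Φ` transports the relation between the sections of `Q` over `f ∘ p` and `f ∘
q`. The cocycles of `P` and `Q` can therefore be compared without any coboundary correction. -/
lemma PlotSections.pull_transition (s : PlotSections Q) {p q : EuclideanPlot X} (φ : p ⟶ q)
    (x : Euc p.dim) :
    (s.pull Φ).transition φ x = s.transition ((EuclideanPlot.push f hf).map φ) x := by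
  refine (s.pull Φ).transition_eq (Φ.toEquiv.injective ?_)
  rw [Φ.equivariant]
  refine (Φ.toEquiv.apply_symm_apply _).trans
    (Eq.trans ?_ (congrArg _ (Φ.toEquiv.apply_symm_apply _)).symm)
  exact Subtype.ext (Prod.ext (φ.comm x).symm (s.sec_eq ((EuclideanPlot.push f hf).map φ) x))

/-- `Φ` sends the tautological points of the pulled-back trivialization to those of `Q`, so a
pulled-back section has the same coordinates. -/
lemma sectionFun_localSystemPull_point (s : PlotSections Q) {χ : ℤˣ →* ℤˣ} {M : Type*}
    [AddCommGroup M] [DiffeologicalSpace M] [DiffeologicalAddGroup M] (p : EuclideanPlot X)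
    (m : (localSystem Q χ M).obj (op ((EuclideanPlot.push f hf).obj p))) (x : Euc p.dim) :
    sectionFun ((localSystemPull f hf Φ χ M).app p m) ((s.pull Φ).point p x) =
      sectionFun m (s.point _ x) := by
  refine congrArg (sectionFun m) (Subtype.ext (Prod.ext rfl ?_))
  exact congrArg (fun z => z.1.2) (Φ.toEquiv.apply_symm_apply _)

variable {E : CircleExtension σ Ghat}

/-- The lifts of the transition functions of `P ≅ f^*Q` induced by those of `Q`. -/
def LiftingData.pull (L : LiftingData E Q) : LiftingData E P where
  toPlotSections := L.toPlotSections.pull Φ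
  lift _ _ φ := L.lift ((EuclideanPlot.push f hf).map φ)
  isPlot_lift _ _ φ := L.isPlot_lift ((EuclideanPlot.push f hf).map φ)
  quot_lift p q φ x := by
    rw [L.toPlotSections.pull_transition Φ]
    exact L.quot_lift ((EuclideanPlot.push f hf).map φ) x

lemma IsAlpha.pull (Φ : P.Iso (Q.pullback f hf)) {a : H1 (constZ2 Y)} (ha : IsAlpha Q a) :
    IsAlpha P ((z2Pull f hf).mapH1 a) := by
  obtain ⟨s, c, hc, rfl⟩ := ha
  exact ⟨s.pull Φ, _, fun p q φ x =>
    (congrArg SemidirectProduct.right (s.pull_transition Φ φ x)).trans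
      (hc ((EuclideanPlot.push f hf).map φ) x), rfl⟩

lemma IsBeta.pull {b : H2 (circleSystem E Q)} (hb : IsBeta E Q b) :
    IsBeta E P ((localSystemPull f hf Φ E.character (Additive Circle)).mapH2 b) := by
  obtain ⟨L, a, ha, rfl⟩ := hb
  refine ⟨L.pull Φ, _, fun p q r φ ψ x => ?_, rfl⟩
  refine (congrArg (fun z : Additive Circle => E.incl z.toMul)
    (sectionFun_localSystemPull_point Φ L.toPlotSections p _ x)).trans ?_
  refine (ha ((EuclideanPlot.push f hf).map φ) ((EuclideanPlot.push f hf).map ψ) x).trans ?_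
  have h : (L.pull Φ).transition φ x = L.transition ((EuclideanPlot.push f hf).map φ) x :=
    L.toPlotSections.pull_transition Φ φ x
  rw [h]
  rfl

/-- The cochains `a`, `r` and `n` are pulled back together: the exponential relation is pointwise,
and pull-back commutes with the differential. -/
lemma IsConnecting.pull {b : H2 (circleSystem E Q)} {d : H3 (intSystem E Q)}
    (h : IsConnecting E Q b d) :
    IsConnecting E P ((localSystemPull f hf Φ E.character (Additive Circle)).mapH2 b)
      ((localSystemPull f hf Φ E.character ℤ).mapH3 d) := by
  obtain ⟨a, r, n, har, hrn, rfl, rfl⟩ := h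
  refine ⟨_, (localSystemPull f hf Φ E.character ℝ).pull2 r, _, fun p q s φ ψ z => ?_,
    fun p q s t φ ψ θ z => ?_, rfl, rfl⟩
  · exact har ((EuclideanPlot.push f hf).map φ) ((EuclideanPlot.push f hf).map ψ) _
  · rw [CoeffMap.d2_pull]
    exact hrn ((EuclideanPlot.push f hf).map φ) ((EuclideanPlot.push f hf).map ψ)
      ((EuclideanPlot.push f hf).map θ) _

lemma IsTwistingDatum.pull {t : TwistGroup E Q} (h : IsTwistingDatum E Q t) :
    IsTwistingDatum E P (twistPull E f hf Φ t) := by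
  obtain ⟨ha, b, hb, hd⟩ := h
  exact ⟨ha.pull Φ, _, hb.pull Φ, hd.pull Φ⟩

end Naturality

end SphericalTwist

end

theorem mainTheorem9 {G : Type*} [Group G] [DiffeologicalSpace G] [DiffeologicalGroup G]
    (σ : ℤˣ →* MulAut G) (hσ : ∀ ε, DSmooth (σ ε))
    {Ghat : Type*} [Group Ghat] [DiffeologicalSpace Ghat] [DiffeologicalGroup Ghat]
    (E : CircleExtension σ Ghat)
    {X : Type*} [DiffeologicalSpace X] (P : PrincipalBundle (HGroup σ) X)
    (f : X → BSph σ) (hf : DSmooth f) (Φ : P.Iso ((universalBundle σ hσ).pullback f hf)) :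
    (∃! t, IsTwistingDatum E (universalBundle σ hσ) t) ∧
      (∃! t, IsTwistingDatum E P t) ∧
      twistingDatum E P = twistPull E f hf Φ (twistingDatum E (universalBundle σ hσ)) :=
  ⟨existsUnique_isTwistingDatum E _, existsUnique_isTwistingDatum E P,
    (existsUnique_isTwistingDatum E P).unique (isTwistingDatum_twistingDatum E P)
      ((isTwistingDatum_twistingDatum E _).pull Φ)⟩
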